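/- **Theorem (Lax pair for the periodic ncILW equation).** Let $L,\delta>0$ and let $$\zeta_1(z)=\frac{\pi}{L}\lim_{M\to\infty}\sum_{n=-M}^{M}\cot\Big(\frac{\pi}{L}(z-2\mathrm{i}n\delta)\Big),$$ $$(Tf)(x)=\frac1\pi\,\mathrm{p.v.}\!\int_{-L/2}^{L/2}\zeta_1(x'-x)f(x')\,dx',\qquad (\tilde Tf)(x)=\frac1\pi\int_{-L/2}^{L/2}\zeta_1(x'-x+\mathrm{i}\delta)f(x')\,dx'.$$ Let $u,v:\mathbb R\times\mathbb R\to\mathbb C$ be smooth functions of $(x,t)$, $L$-periodic in $x$. The periodic ncILW equation is $$u_t+2uu_x+Tu_{xx}+\tilde Tv_{xx}=0,\qquad v_t-2vv_x-Tv_{xx}-\tilde Tu_{xx}=0\qquad (x,t\in\mathbb R).\tag{1}$$ On the torus $\Pi=\mathbb C/(L\mathbb Z+2\mathrm{i}\delta\mathbb Z)$ let $\Pi_0$, $\Pi_\delta$ be the images of $\operatorname{Im}z=0$ and $\operatorname{Im}z=\delta$, and for a function $\psi(z,t)$, $z\in\Pi\setminus(\Pi_0\cup\Pi_\delta)$, let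 $\psi^\pm$ be its boundary values on $\Pi_0\cup\Pi_\delta$ from above ($+$) and below ($-$). Let $\mu,\nu_1,\nu_2,A_0$ be complex numbers, which may depend on a spectral parameter $k\in\mathbb C$. Then, for each $k$, (1) is the compatibility condition of the Lax pair $$\begin{cases} \mathrm{i}\psi_x^-+(-u-\mu)\psi^-=\nu_1\psi^+&\text{on }\Pi_0,\\ \mathrm{i}\psi_x^++(v-\mu)\psi^+=\nu_2\psi^-&\text{on }\Pi_\delta,\\ \psi_t^\pm+\mathrm{i}\psi_{xx}^\pm-2\mu\psi_x^\pm-\mathrm{i}(Tu_x+\tilde Tv_x\pm\mathrm{i}u_x+A_0)\psi^\pm=0&\text{on }\Pi_0,\\ \psi_t^\pm+\mathrm{i}\psi_{xx}^\pm-2\mu\psi_x^\pm-\mathrm{i}(Tv_x+\tilde Tu_x\pm\mathrm{i}v_x+A_0)\psi^\pm=0&\text{on }\Pi_\delta, \end{cases}\tag{2}$$ whose first two equations form the $x$-part and whose last two form the $t$-part, in the following sense. 1. $(u,v)$ solves (1) if and only if (2) is compatible: for every $t_0\in\mathbb R$ and all smooth functions $\psi^\pm(x,t)$, $\psi^\pm(x+\mathrm{i}\delta,t)$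 of $(x,t)\in\mathbb R^2$ that satisfy the $x$-part and the $t$-part at $t=t_0$ (for all $x$), the $t$-derivative of the $x$-part holds at $t=t_0$ (for all $x$). 2. If $\nu_1,\nu_2\neq0$, the same equivalence holds with compatibility required only for functions $\psi^\pm$ that are $L$-periodic in $x$, i.e. functions on $\Pi_0$ and $\Pi_\delta$. 3. Let $\psi(z,t)$, for each $t\in\mathbb R$, be analytic on $\Pi\setminus(\Pi_0\cup\Pi_\delta)$ and extend continuously to $\Pi_0$ and $\Pi_\delta$ from either side, with boundary values $\psi^\pm$ that are smooth in $(x,t)$ and satisfy (2) for all $t$. If for every $t$ the function $\psi(\cdot,t)$ is not identically zero (and, in case $\nu_1=\nu_2=0$, not identically zero on $-\delta<\operatorname{Im}z<0$), then $(u,v)$ solves (1). -/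

import Mathlib

open Filter Topology
open scoped ContDiff

namespace NcILW

noncomputable section

/-- The modified Weierstrass zeta function with periods `L` and `2iδ`, as a symmetric limit:
`ζ₁(z | L/2, iδ) = (π/L) lim_{M → ∞} ∑_{n=-M}^{M} cot ((π/L) (z - 2inδ))`. -/
def zeta1 (L δ : ℝ) (z : ℂ) : ℂ :=
  ((Real.pi / L : ℝ) : ℂ) *
    limUnder atTop (fun M : ℕ =>
      ∑ n ∈ Finset.Icc (-(M : ℤ)) (M : ℤ),
        Complex.cot (((Real.pi / L : ℝ) : ℂ) * (z - 2 * Complex.I * (n : ℂ) * (δ : ℂ))))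

/-- The period interval with the `ε`-neighbourhoods of the poles `x + L ℤ` of the kernel removed. -/
def puncturedPeriod (L x ε : ℝ) : Set ℝ :=
  {y : ℝ | y ∈ Set.Ioc (-(L / 2)) (L / 2) ∧ ∀ m : ℤ, ε < |y - x - (m : ℝ) * L|}

/-- `(T f)(x) = (1/π) p.v. ∫_{-L/2}^{L/2} ζ₁(x' - x) f(x') dx'`. -/
def opT (L δ : ℝ) (f : ℝ → ℂ) (x : ℝ) : ℂ :=
  ((1 / Real.pi : ℝ) : ℂ) *
    limUnder (𝓝[>] (0 : ℝ)) (fun ε : ℝ =>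
      ∫ y in puncturedPeriod L x ε, zeta1 L δ ((y - x : ℝ) : ℂ) * f y)

/-- `(T̃ f)(x) = (1/π) ∫_{-L/2}^{L/2} ζ₁(x' - x + iδ) f(x') dx'`. -/
def opTt (L δ : ℝ) (f : ℝ → ℂ) (x : ℝ) : ℂ :=
  ((1 / Real.pi : ℝ) : ℂ) *
    ∫ y in (-(L / 2))..(L / 2), zeta1 L δ (((y - x : ℝ) : ℂ) + Complex.I * (δ : ℂ)) * f y

/-- Partial derivatives of a function of `(x, t)`. -/
def dx (f : ℝ → ℝ → ℂ) (x t : ℝ) : ℂ := deriv (fun y => f y t) x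

def dt (f : ℝ → ℝ → ℂ) (x t : ℝ) : ℂ := deriv (fun s => f x s) t

/-- Joint smoothness in `(x, t)`. -/
def Smooth (f : ℝ → ℝ → ℂ) : Prop := ContDiff ℝ ∞ (fun p : ℝ × ℝ => f p.1 p.2)

/-- `L`-periodicity in `x`. -/
def XPeriodic (L : ℝ) (f : ℝ → ℝ → ℂ) : Prop := ∀ x t : ℝ, f (x + L) t = f x t

/-- The periodic ncILW equation for `(u, v)`. -/
def IsSolution (L δ : ℝ) (u v : ℝ → ℝ → ℂ) : Prop :=
  ∀ x t : ℝ,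
    dt u x t + 2 * u x t * dx u x t
        + opT L δ (fun y => dx (dx u) y t) x + opTt L δ (fun y => dx (dx v) y t) x = 0 ∧
    dt v x t - 2 * v x t * dx v x t
        - opT L δ (fun y => dx (dx v) y t) x - opTt L δ (fun y => dx (dx u) y t) x = 0

/-- The four boundary functions of an eigenfunction: from above (`pos`) and from below (`neg`)
on `Π₀` (points `x`) and on `Π_δ` (points `x + iδ`), as functions of `(x, t)`. -/
structure ContourData where
  pos₀ : ℝ → ℝ → ℂ
  neg₀ : ℝ → ℝ → ℂ
  posδ : ℝ → ℝ → ℂ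
  negδ : ℝ → ℝ → ℂ

def ContourData.IsSmooth (Ψ : ContourData) : Prop :=
  Smooth Ψ.pos₀ ∧ Smooth Ψ.neg₀ ∧ Smooth Ψ.posδ ∧ Smooth Ψ.negδ

def ContourData.IsPeriodic (L : ℝ) (Ψ : ContourData) : Prop :=
  XPeriodic L Ψ.pos₀ ∧ XPeriodic L Ψ.neg₀ ∧ XPeriodic L Ψ.posδ ∧ XPeriodic L Ψ.negδ

/-- Left-hand side minus right-hand side of `i ψ⁻_x + (-u - μ) ψ⁻ = ν₁ ψ⁺` on `Π₀`. -/
def xDefect₀ (u : ℝ → ℝ → ℂ) (μ ν₁ : ℂ) (Ψ : ContourData) (x t : ℝ) : ℂ :=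
  Complex.I * dx Ψ.neg₀ x t + (-u x t - μ) * Ψ.neg₀ x t - ν₁ * Ψ.pos₀ x t

/-- Left-hand side minus right-hand side of `i ψ⁺_x + (v - μ) ψ⁺ = ν₂ ψ⁻` on `Π_δ`. -/
def xDefectδ (v : ℝ → ℝ → ℂ) (μ ν₂ : ℂ) (Ψ : ContourData) (x t : ℝ) : ℂ :=
  Complex.I * dx Ψ.posδ x t + (v x t - μ) * Ψ.posδ x t - ν₂ * Ψ.negδ x t

/-- The `x`-part of the Lax pair holds at time `t`. -/
def XPart (u v : ℝ → ℝ → ℂ) (μ ν₁ ν₂ : ℂ) (Ψ : ContourData) (t : ℝ) : Prop :=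
  ∀ x : ℝ, xDefect₀ u μ ν₁ Ψ x t = 0 ∧ xDefectδ v μ ν₂ Ψ x t = 0

/-- `φ_t + i φ_xx - 2 μ φ_x - i (T f_x + T̃ g_x + σ i f_x + A₀) φ = 0` at the point `(x, t)`. -/
def TEquation (L δ : ℝ) (f g : ℝ → ℝ → ℂ) (μ A₀ σ : ℂ) (φ : ℝ → ℝ → ℂ) (x t : ℝ) : Prop :=
  dt φ x t + Complex.I * dx (dx φ) x t - 2 * μ * dx φ x t
    - Complex.I * (opT L δ (fun y => dx f y t) x + opTt L δ (fun y => dx g y t) x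
        + σ * (Complex.I * dx f x t) + A₀) * φ x t = 0

/-- The `t`-part of the Lax pair (the four equations on `Π₀` and `Π_δ`) holds at time `t`. -/
def TPart (L δ : ℝ) (u v : ℝ → ℝ → ℂ) (μ A₀ : ℂ) (Ψ : ContourData) (t : ℝ) : Prop :=
  ∀ x : ℝ,
    TEquation L δ u v μ A₀ 1 Ψ.pos₀ x t ∧ TEquation L δ u v μ A₀ (-1) Ψ.neg₀ x t ∧
    TEquation L δ v u μ A₀ 1 Ψ.posδ x t ∧ TEquation L δ v u μ A₀ (-1) Ψ.negδ x t

/-- The `t`-derivative of the `x`-part holds at time `t`. -/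
def XPartDifferentiated (u v : ℝ → ℝ → ℂ) (μ ν₁ ν₂ : ℂ) (Ψ : ContourData) (t : ℝ) : Prop :=
  ∀ x : ℝ, dt (xDefect₀ u μ ν₁ Ψ) x t = 0 ∧ dt (xDefectδ v μ ν₂ Ψ) x t = 0

/-- Compatibility of the Lax pair (cross-differentiation): for arbitrary smooth data on the lines
`Im z = 0` and `Im z = δ` which at a time `t₀` satisfy the `x`-part and whose `t`-derivatives at
`t₀` are those prescribed by the `t`-part, the `t`-derivative of the `x`-part holds at `t₀`. -/
def Compatible (L δ : ℝ) (u v : ℝ → ℝ → ℂ) (μ ν₁ ν₂ A₀ : ℂ) : Prop :=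
  ∀ (Ψ : ContourData) (t₀ : ℝ), Ψ.IsSmooth →
    XPart u v μ ν₁ ν₂ Ψ t₀ → TPart L δ u v μ A₀ Ψ t₀ → XPartDifferentiated u v μ ν₁ ν₂ Ψ t₀

/-- The same with `L`-periodic data only, that is, for data on the closed curves `Π₀`, `Π_δ`. -/
def CompatiblePeriodic (L δ : ℝ) (u v : ℝ → ℝ → ℂ) (μ ν₁ ν₂ A₀ : ℂ) : Prop :=
  ∀ (Ψ : ContourData) (t₀ : ℝ), Ψ.IsSmooth → Ψ.IsPeriodic L →
    XPart u v μ ν₁ ν₂ Ψ t₀ → TPart L δ u v μ A₀ Ψ t₀ → XPartDifferentiated u v μ ν₁ ν₂ Ψ t₀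

/-- Complement of the preimage in `ℂ` of `Π₀ ∪ Π_δ` under `ℂ → ℂ / (L ℤ + 2iδ ℤ)`. -/
def offContour (δ : ℝ) : Set ℂ := {z : ℂ | ∀ n : ℤ, z.im ≠ (n : ℝ) * δ}

/-- `ψ(z, t)` is an eigenfunction of the Lax pair: a doubly periodic function of `z`, i.e. a
function on the torus `ℂ / (L ℤ + 2iδ ℤ)`, analytic off `Π₀ ∪ Π_δ`, extending continuously to
`Π₀` and `Π_δ` from each side, with boundary values `Ψ` that are smooth in `(x, t)` and satisfy
the `x`-part and the `t`-part for all times. -/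
structure IsEigenfunction (L δ : ℝ) (u v : ℝ → ℝ → ℂ) (μ ν₁ ν₂ A₀ : ℂ)
    (ψ : ℂ → ℝ → ℂ) (Ψ : ContourData) : Prop where
  periodic_real : ∀ (z : ℂ) (t : ℝ), ψ (z + (L : ℂ)) t = ψ z t
  periodic_imag : ∀ (z : ℂ) (t : ℝ), ψ (z + 2 * Complex.I * (δ : ℂ)) t = ψ z t
  analytic : ∀ t : ℝ, DifferentiableOn ℂ (fun z => ψ z t) (offContour δ)
  boundary_pos₀ : ∀ x t : ℝ,
    Tendsto (fun z => ψ z t) (𝓝[{z : ℂ | 0 < z.im}] (x : ℂ)) (𝓝 (Ψ.pos₀ x t))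
  boundary_neg₀ : ∀ x t : ℝ,
    Tendsto (fun z => ψ z t) (𝓝[{z : ℂ | z.im < 0}] (x : ℂ)) (𝓝 (Ψ.neg₀ x t))
  boundary_posδ : ∀ x t : ℝ,
    Tendsto (fun z => ψ z t) (𝓝[{z : ℂ | δ < z.im}] ((x : ℂ) + Complex.I * (δ : ℂ)))
      (𝓝 (Ψ.posδ x t))
  boundary_negδ : ∀ x t : ℝ,
    Tendsto (fun z => ψ z t) (𝓝[{z : ℂ | z.im < δ}] ((x : ℂ) + Complex.I * (δ : ℂ)))
      (𝓝 (Ψ.negδ x t))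
  smooth : Ψ.IsSmooth
  xPart : ∀ t : ℝ, XPart u v μ ν₁ ν₂ Ψ t
  tPart : ∀ t : ℝ, TPart L δ u v μ A₀ Ψ t

end

end NcILW

/-! On one component of the contour put `q = u` on `Π₀` and `q = -v` on `Π_δ`. The `x`-part reads
`(i∂ₓ - q - μ) φ = ν χ`, where `φ` is the boundary value that is differentiated and `χ` the opposite
one. Their evolution operators differ only by the potential term `2qₓ`, and this difference is
exactly what is needed for the two evolutions to intertwine `i∂ₓ - q - μ` up to multiplication by
`q_t + 2qqₓ + Wₓ`, with `W` the nonlocal potential common to both. Because `T` and `T̃` commute with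
`∂ₓ`, this is, up to sign, the left-hand side of the ncILW equation on that component, and so the
`t`-derivative of the `x`-part holds exactly when its product with `φ` vanishes.

It remains to find `φ ≠ 0` at every point, or on a dense set of points. For arbitrary smooth data,
solve the `x`-part as a linear ordinary differential equation with `χ = 0`; for periodic data and
`ν ≠ 0`, take `φ = 1` and solve the `x`-part for `χ`. For an eigenfunction, both `φ` are boundary
values from the strip `-δ < Im z < 0` of the torus; an interval of zeros of `φ` would force the
eigenfunction to vanish on that strip, hence, by the `x`-part with some `ν ≠ 0`, on the other strip
as well. -/

namespace NcILW

noncomputable section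

section BoundaryUniqueness

open Complex Set
open scoped Interval

theorem boundaryValue_eq_zero {X : Type*} [TopologicalSpace X] [T2Space X] [Zero X] {F : ℂ → X}
    {φ : ℝ → X} {s : Set ℝ} {c : ℝ} (hc : c ∈ closure s)
    (hφ : ∀ x : ℝ, Tendsto F (𝓝[im ⁻¹' s] (x + c * I)) (𝓝 (φ x)))
    (hF : EqOn F 0 (im ⁻¹' s)) (x : ℝ) : φ x = 0 := by
  have : (𝓝[im ⁻¹' s] (x + c * I : ℂ)).NeBot := by
    rw [← mem_closure_iff_nhdsWithin_neBot, closure_preimage_im]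
    simpa using hc
  exact tendsto_nhds_unique (hφ x)
    (tendsto_const_nhds.congr' (hF.symm.eventuallyEq_of_mem self_mem_nhdsWithin))

variable {E : Type*} [NormedAddCommGroup E] [NormedSpace ℂ E] {F : ℂ → E} {c : ℝ}

/-- Cut the rectangle along the line `im z = c`, if it meets it. -/
theorem wedgeIntegral_add_wedgeIntegral_eq_zero_of_off_line {z w : ℂ}
    (hF : ContinuousOn F (Rectangle z w))
    (hd : ∀ p ∈ Rectangle z w, p.im ≠ c → DifferentiableAt ℂ F p) :
    wedgeIntegral z w F + wedgeIntegral w z F = 0 := by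
  have subrectangle : ∀ p q : ℝ, [[p, q]] ⊆ [[z.im, w.im]] → c ∉ Ioo (min p q) (max p q) →
      (∫ x : ℝ in z.re..w.re, F (x + p * I)) - (∫ x : ℝ in z.re..w.re, F (x + q * I)) +
        I • (∫ y : ℝ in p..q, F (w.re + y * I)) - I • (∫ y : ℝ in p..q, F (z.re + y * I)) = 0 := by
    intro p q hpq hc
    refine integral_boundary_rect_eq_zero_of_continuousOn_of_differentiableOn F ⟨z.re, p⟩ ⟨w.re, q⟩
      (hF.mono (reProdIm_subset_iff.2 (prod_mono subset_rfl hpq))) ?_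
    rintro s ⟨hs_re, hs_im⟩
    exact (hd s ⟨Ioo_subset_Icc_self hs_re, hpq (Ioo_subset_Icc_self hs_im)⟩
      (fun h ↦ hc (h ▸ hs_im))).differentiableWithinAt
  rw [wedgeIntegral_add_wedgeIntegral_eq]
  by_cases hc : c ∈ [[z.im, w.im]]
  · have vertical_integrable : ∀ r ∈ [[z.re, w.re]], ∀ p q : ℝ, [[p, q]] ⊆ [[z.im, w.im]] →
        IntervalIntegrable (fun y : ℝ ↦ F ((r : ℂ) + y * I)) MeasureTheory.volume p q :=
      fun r hr p q hpq ↦ (hF.comp (by fun_prop) fun y hy ↦ by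
        simpa [Rectangle, mem_reProdIm, hr] using hpq hy).intervalIntegrable
    have split_at : ∀ r ∈ [[z.re, w.re]],
        (∫ y : ℝ in z.im..w.im, F ((r : ℂ) + y * I)) =
        (∫ y : ℝ in z.im..c, F ((r : ℂ) + y * I)) + ∫ y : ℝ in c..w.im, F ((r : ℂ) + y * I) :=
      fun r hr ↦ (intervalIntegral.integral_add_adjacent_intervals
        (vertical_integrable r hr _ _ (uIcc_subset_uIcc_left hc))
        (vertical_integrable r hr _ _ (uIcc_subset_uIcc_right hc))).symm
    have lower := subrectangle z.im c (uIcc_subset_uIcc_left hc)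
      (by simpa using le_of_lt)
    have upper := subrectangle c w.im (uIcc_subset_uIcc_right hc)
      (by simpa using le_of_lt)
    rw [split_at _ right_mem_uIcc, split_at _ left_mem_uIcc, smul_add, smul_add]
    linear_combination (norm := module) lower + upper
  · exact subrectangle _ _ subset_rfl fun h ↦ hc (Ioo_subset_Icc_self h)

variable [CompleteSpace E]

theorem differentiableOn_of_continuousOn_of_off_line {U : Set ℂ} (hU : IsOpen U)
    (hF : ContinuousOn F U) (hd : ∀ z ∈ U, z.im ≠ c → DifferentiableAt ℂ F z) :
    DifferentiableOn ℂ F U :=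
  (isConservativeOn_and_continuousOn_iff_isDifferentiableOn hU).1
    ⟨fun _ _ hzw ↦ eq_neg_of_add_eq_zero_left <|
      wedgeIntegral_add_wedgeIntegral_eq_zero_of_off_line (hF.mono hzw)
        fun p hp ↦ hd p (hzw hp), hF⟩

theorem differentiableOn_indicator_of_tendsto_zero {Ω B : Set ℂ} (hΩ : IsOpen Ω) (hB : IsOpen B)
    (hF : DifferentiableOn ℂ F Ω) (hline : ∀ z ∈ B ∩ frontier Ω, z.im = c)
    (h0 : ∀ z ∈ B ∩ frontier Ω, Tendsto F (𝓝[Ω] z) (𝓝 0)) :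
    DifferentiableOn ℂ (Ω.indicator F) B := by
  have not_mem_of_frontier : ∀ z ∈ frontier Ω, z ∉ Ω := fun z hz ↦
    hΩ.frontier_eq ▸ hz |>.2
  refine differentiableOn_of_continuousOn_of_off_line (c := c) hB ?_ fun z hz hzc ↦ ?_
  · classical
    rw [← piecewise_eq_indicator]
    refine ContinuousOn.piecewise' (fun z hz ↦ ?_) (fun z hz ↦ ?_)
      (hF.continuousOn.mono inter_subset_right) continuousOn_const
    · rw [piecewise_eq_of_notMem _ _ _ (not_mem_of_frontier z hz.2)]
      exact (h0 z hz).mono_left (nhdsWithin_mono _ inter_subset_right)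
    · rw [piecewise_eq_of_notMem _ _ _ (not_mem_of_frontier z hz.2)]
      exact tendsto_const_nhds
  · by_cases hzΩ : z ∈ Ω
    · refine (hF.differentiableAt (hΩ.mem_nhds hzΩ)).congr_of_eventuallyEq ?_
      exact (eqOn_indicator (f := F)).eventuallyEq_of_mem (hΩ.mem_nhds hzΩ)
    · have hz_closure : z ∉ closure Ω := fun h ↦
        hzc (hline z ⟨hz, hΩ.frontier_eq ▸ ⟨h, hzΩ⟩⟩)
      refine (differentiableAt_const (0 : E)).congr_of_eventuallyEq ?_
      filter_upwards [isClosed_closure.isOpen_compl.mem_nhds hz_closure] with w hw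
      exact indicator_of_notMem (fun h ↦ hw (subset_closure h)) F

theorem eqOn_zero_of_tendsto_zero_frontier {Ω B : Set ℂ} (hΩ : IsOpen Ω) (hΩc : IsPreconnected Ω)
    (hB : IsOpen B) (hBc : IsPreconnected B) (hF : DifferentiableOn ℂ F Ω)
    (hline : ∀ z ∈ B ∩ frontier Ω, z.im = c)
    (h0 : ∀ z ∈ B ∩ frontier Ω, Tendsto F (𝓝[Ω] z) (𝓝 0))
    (hin : (B ∩ Ω).Nonempty) (hout : (B \ closure Ω).Nonempty) : EqOn F 0 Ω := by
  obtain ⟨p, hpB, hpΩ⟩ := hin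
  obtain ⟨q, hqB, hqΩ⟩ := hout
  have extension_zero : EqOn (Ω.indicator F) 0 B := by
    refine ((differentiableOn_indicator_of_tendsto_zero hΩ hB hF hline h0).analyticOnNhd
      hB).eqOn_zero_of_preconnected_of_eventuallyEq_zero hBc hqB ?_
    filter_upwards [isClosed_closure.isOpen_compl.mem_nhds hqΩ] with w hw
    exact indicator_of_notMem (fun h ↦ hw (subset_closure h)) F
  refine (hF.analyticOnNhd hΩ).eqOn_zero_of_preconnected_of_eventuallyEq_zero hΩc hpΩ ?_
  filter_upwards [hB.mem_nhds hpB, hΩ.mem_nhds hpΩ] with w hwB hwΩ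
  rw [← indicator_of_mem hwΩ F, extension_zero hwB]

variable {a b : ℝ} {φ : ℝ → E}

theorem dense_boundaryValues_ne_zero (hab : a < b) (hc : c ∈ frontier (Ioo a b))
    (hF : DifferentiableOn ℂ F (im ⁻¹' Ioo a b))
    (hφ : ∀ x : ℝ, Tendsto F (𝓝[im ⁻¹' Ioo a b] (x + c * I)) (𝓝 (φ x)))
    (hne : ∃ z ∈ im ⁻¹' Ioo a b, F z ≠ 0) : Dense {x | φ x ≠ 0} := by
  have c_eq : c = a ∨ c = b := by simpa [frontier_Ioo hab] using hc
  obtain ⟨z, hz, hFz⟩ := hne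
  refine Metric.dense_iff.2 fun x₀ r hr ↦ not_disjoint_iff_nonempty_inter.1 fun hdisj ↦ hFz ?_
  have φ_zero : ∀ x ∈ Metric.ball x₀ r, φ x = 0 := fun x hx ↦
    not_not.1 (disjoint_left.1 hdisj hx)
  have on_line : ∀ w ∈ (Metric.ball x₀ r ×ℂ Metric.ball c (b - a)) ∩ frontier (im ⁻¹' Ioo a b),
      w.im = c := by
    rintro w ⟨⟨-, hw⟩, hw'⟩
    rw [frontier_preimage_im, frontier_Ioo hab] at hw'
    rw [mem_preimage, Metric.mem_ball, Real.dist_eq, abs_lt] at hw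
    rcases hw' with h | h <;> rcases c_eq with rfl | rfl <;> grind
  have strip_convex : Convex ℝ (im ⁻¹' Ioo a b) := (convex_Ioo a b).linear_preimage imLm
  have box_convex : Convex ℝ (Metric.ball x₀ r ×ℂ Metric.ball c (b - a)) :=
    ((convex_ball x₀ r).linear_preimage reLm).inter
      ((convex_ball c (b - a)).linear_preimage imLm)
  refine eqOn_zero_of_tendsto_zero_frontier (isOpen_Ioo.preimage continuous_im)
    strip_convex.isPreconnected (Metric.isOpen_ball.reProdIm Metric.isOpen_ball)
    box_convex.isPreconnected hF on_line (fun w hw ↦ ?_) ⟨⟨x₀, (a + b) / 2⟩, ?_⟩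
    ⟨⟨x₀, 2 * c - (a + b) / 2⟩, ?_⟩ hz
  · rw [← φ_zero w.re hw.1.1, ← re_add_im w, on_line w hw]
    simpa using hφ w.re
  · simp only [mem_inter_iff, mem_reProdIm, Metric.mem_ball, dist_self, hr, Real.dist_eq,
      abs_lt, mem_preimage, mem_Ioo]
    grind
  · rw [closure_preimage_im, closure_Ioo hab.ne]
    simp only [Set.mem_sdiff, mem_reProdIm, Metric.mem_ball, dist_self, hr, Real.dist_eq,
      abs_lt, mem_preimage, mem_Icc]
    grind

end BoundaryUniqueness

section Kernel

open Complex

theorem cot_neg (z : ℂ) : cot (-z) = -cot z := by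
  simp [cot, div_neg]

theorem cot_add_pi (z : ℂ) : cot (z + Real.pi) = cot z := by
  simp [cot, cos_add_pi, sin_add_pi]

theorem measurable_cot : Measurable cot :=
  measurable_cos.div measurable_sin

theorem norm_cot_add_I_le {w : ℂ} (hw : 0 < w.im) : ‖cot w + I‖ ≤ 1 / w.im ^ 2 := by
  set q := exp (2 * I * w) with hq
  have norm_q : ‖q‖ * (1 + 2 * w.im ^ 2) ≤ 1 :=
    calc ‖q‖ * (1 + 2 * w.im ^ 2) ≤ ‖q‖ * Real.exp (2 * w.im) := by
          have := Real.quadratic_le_exp_of_nonneg (x := 2 * w.im) (by linarith)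
          gcongr
          nlinarith
      _ = 1 := by simp [hq, norm_exp, ← Real.exp_add]
  have im_sq_pos : 0 < w.im ^ 2 := by positivity
  have q_pos : 0 < ‖q‖ := norm_pos_iff.2 (exp_ne_zero _)
  have norm_one_sub_q : 1 - ‖q‖ ≤ ‖1 - q‖ := by simpa using norm_sub_norm_le 1 q
  have one_sub_q_pos : 0 < ‖1 - q‖ := by nlinarith [mul_pos q_pos im_sq_pos]
  have cot_eq : cot w + I = 2 * q / (I * (1 - q)) := by
    have := norm_pos_iff.1 one_sub_q_pos
    rw [cot_eq_exp_ratio, ← hq]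
    field_simp
    linear_combination (1 - q) * I_sq
  rw [cot_eq, norm_div, norm_mul, norm_mul, norm_I, one_mul, norm_ofNat,
    div_le_div_iff₀ one_sub_q_pos im_sq_pos]
  linarith

theorem norm_cot_sub_I_le {w : ℂ} (hw : w.im < 0) : ‖cot w - I‖ ≤ 1 / w.im ^ 2 := by
  simpa [cot_neg, ← norm_neg (cot w - I), neg_add_eq_sub] using
    norm_cot_add_I_le (w := -w) (by simpa using hw)

/-- The `n`-th term of the series defining `zeta1`, less its limit `± i` as `n → ± ∞`. The
subtracted constants cancel in the symmetric partial sums, and the series becomes absolutely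
convergent. -/
def zetaTerm (L δ : ℝ) (z : ℂ) (n : ℤ) : ℂ :=
  cot ((Real.pi / L : ℝ) * (z - 2 * I * n * δ)) - I * n.sign

variable {L δ : ℝ}

theorem zetaTerm_neg (L δ : ℝ) (z : ℂ) (n : ℤ) : zetaTerm L δ (-z) n = -zetaTerm L δ z (-n) := by
  rw [zetaTerm, zetaTerm, ← neg_neg (_ * (-z - _)), cot_neg, Int.sign_neg]
  push_cast
  ring_nf

theorem norm_zetaTerm_le (hL : 0 < L) (hδ : 0 < δ) {z : ℂ} {n : ℤ} (hn : n ≠ 0)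
    (hz : |z.im| ≤ |(n : ℝ)| * δ) :
    ‖zetaTerm L δ z n‖ ≤ 1 / (Real.pi / L * δ) ^ 2 * (1 / (n : ℝ) ^ 2) := by
  set w : ℂ := (Real.pi / L : ℝ) * (z - 2 * I * n * δ) with hw
  have im_w : w.im = Real.pi / L * (z.im - 2 * n * δ) := by
    rw [hw, im_ofReal_mul]
    simp
  have slope_pos : 0 < Real.pi / L := by positivity
  have bound_of_cot : ‖zetaTerm L δ z n‖ ≤ 1 / w.im ^ 2 := by
    rw [zetaTerm, ← hw]
    rcases hn.lt_or_gt with hn | hn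
    · have hn' : (n : ℝ) < 0 := mod_cast hn
      rw [abs_of_neg hn', abs_le] at hz
      have : 0 < w.im := im_w ▸ mul_pos slope_pos (by nlinarith)
      simpa [Int.sign_eq_neg_one_of_neg hn] using norm_cot_add_I_le this
    · have hn' : 0 < (n : ℝ) := mod_cast hn
      rw [abs_of_pos hn', abs_le] at hz
      have : w.im < 0 := im_w ▸ mul_neg_of_pos_of_neg slope_pos (by nlinarith)
      simpa [Int.sign_eq_one_of_pos hn] using norm_cot_sub_I_le this
  have le_abs : Real.pi / L * δ * |(n : ℝ)| ≤ |w.im| := by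
    rw [im_w, abs_mul, abs_of_pos slope_pos, mul_assoc]
    refine mul_le_mul_of_nonneg_left ?_ slope_pos.le
    have := abs_sub_abs_le_abs_sub (2 * n * δ) z.im
    rw [abs_mul, abs_mul, abs_two, abs_of_pos hδ, abs_sub_comm] at this
    linarith
  calc _ ≤ 1 / |w.im| ^ 2 := by rwa [sq_abs]
    _ ≤ 1 / (Real.pi / L * δ * |(n : ℝ)|) ^ 2 := by gcongr
    _ = _ := by rw [mul_pow, sq_abs, one_div_mul_one_div]

theorem summable_zetaTerm (hL : 0 < L) (hδ : 0 < δ) (z : ℂ) : Summable (zetaTerm L δ z) := by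
  refine .of_norm_bounded_eventually
    ((Real.summable_one_div_int_pow.2 one_lt_two).mul_left (1 / (Real.pi / L * δ) ^ 2)) ?_
  have hlarge : ∀ᶠ n : ℤ in cofinite, n ∉ Set.Icc (-⌈|z.im| / δ⌉) ⌈|z.im| / δ⌉ :=
    (Set.finite_Icc _ _).compl_mem_cofinite
  filter_upwards [hlarge] with n hn
  rw [Set.mem_Icc, ← abs_le, not_le] at hn
  refine norm_zetaTerm_le hL hδ ?_ ?_
  · rintro rfl
    exact hn.not_ge (by simpa using Int.ceil_nonneg (by positivity))
  · rw [← div_le_iff₀ hδ]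
    exact (Int.le_ceil _).trans (mod_cast hn.le)

theorem tendsto_sum_zetaTerm (hL : 0 < L) (hδ : 0 < δ) (z : ℂ) :
    Tendsto (fun M : ℕ ↦ ∑ n ∈ Finset.Icc (-(M : ℤ)) M, zetaTerm L δ z n) atTop
      (𝓝 (∑' n, zetaTerm L δ z n)) :=
  (summable_zetaTerm hL hδ z).hasSum.comp Finset.tendsto_Icc_neg

theorem zeta1_eq_tsum (hL : 0 < L) (hδ : 0 < δ) (z : ℂ) :
    zeta1 L δ z = (Real.pi / L : ℝ) * ∑' n, zetaTerm L δ z n := by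
  have sum_sign (M : ℕ) : ∑ n ∈ Finset.Icc (-(M : ℤ)) M, I * (n.sign : ℂ) = 0 :=
    Function.Odd.finsetSum_eq_zero (fun n ↦ by simp) (by ext n; simp; omega)
  rw [zeta1, ← (tendsto_sum_zetaTerm hL hδ z).limUnder_eq]
  simp only [zetaTerm, Finset.sum_sub_distrib, sum_sign, sub_zero]

theorem zeta1_neg (hL : 0 < L) (hδ : 0 < δ) (z : ℂ) : zeta1 L δ (-z) = -zeta1 L δ z := by
  simp only [zeta1_eq_tsum hL hδ, zetaTerm_neg, tsum_neg, mul_neg]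
  rw [← (Equiv.neg ℤ).tsum_eq (zetaTerm L δ z)]
  rfl

theorem zeta1_add_period (hL : L ≠ 0) (δ : ℝ) (z : ℂ) : zeta1 L δ (z + L) = zeta1 L δ z := by
  have hL' : (L : ℂ) ≠ 0 := mod_cast hL
  have shift (n : ℤ) : (Real.pi / L : ℝ) * (z + L - 2 * I * n * δ) =
      (Real.pi / L : ℝ) * (z - 2 * I * n * δ) + Real.pi := by
    push_cast
    field_simp
    ring
  simp only [zeta1, shift, cot_add_pi]

theorem measurable_zeta1 (hL : 0 < L) (hδ : 0 < δ) : Measurable (zeta1 L δ) := by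
  rw [funext (zeta1_eq_tsum hL hδ)]
  refine (measurable_of_tendsto_metrizable (fun M ↦ Finset.measurable_fun_sum _ fun n _ ↦ ?_)
    (tendsto_pi_nhds.2 (tendsto_sum_zetaTerm hL hδ))).const_mul _
  exact (measurable_cot.comp (by fun_prop)).sub_const _

theorem exists_norm_zeta1_le (hL : 0 < L) (hδ : 0 < δ) :
    ∃ K : ℝ, 0 ≤ K ∧ ∀ z : ℂ, |z.im| ≤ δ →
      ‖zeta1 L δ z‖ ≤ Real.pi / L * (‖cot ((Real.pi / L : ℝ) * z)‖ + K) := by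
  have hsum := (Real.summable_one_div_int_pow.2 one_lt_two).mul_left (1 / (Real.pi / L * δ) ^ 2)
  refine ⟨∑' n : ℤ, 1 / (Real.pi / L * δ) ^ 2 * (1 / (n : ℝ) ^ 2),
    tsum_nonneg fun n ↦ by positivity, fun z hz ↦ ?_⟩
  rw [zeta1_eq_tsum hL hδ, norm_mul, norm_real, Real.norm_of_nonneg (by positivity)]
  gcongr
  refine tsum_of_norm_bounded
    ((hasSum_pi_single 0 ‖cot ((Real.pi / L : ℝ) * z)‖).add hsum.hasSum) fun n ↦ ?_
  rcases eq_or_ne n 0 with rfl | hn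
  · simp [zetaTerm]
  · rw [Pi.single_eq_of_ne hn, zero_add]
    refine norm_zetaTerm_le hL hδ hn (hz.trans (le_mul_of_one_le_left hδ.le ?_))
    exact mod_cast Int.one_le_abs hn

theorem norm_cot_mul_le (hL : 0 < L) {s : ℝ} (hs : s ∈ Set.Ioc 0 (L / 2)) :
    ‖cot ((Real.pi / L : ℝ) * s)‖ ≤ L / 2 / s := by
  have sin_ge : s / (L / 2) ≤ Real.sin (Real.pi / L * s) := by
    have := Real.mul_le_sin (x := Real.pi / L * s) (by have := hs.1; positivity)
      (by calc Real.pi / L * s ≤ Real.pi / L * (L / 2) := by have := hs.2; gcongr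
            _ = Real.pi / 2 := by field_simp)
    calc s / (L / 2) = 2 / Real.pi * (Real.pi / L * s) := by field_simp
      _ ≤ _ := this
  have sin_pos : 0 < s / (L / 2) := div_pos hs.1 (by positivity)
  rw [← ofReal_mul, cot, ← ofReal_cos, ← ofReal_sin, norm_div, norm_real, norm_real,
    Real.norm_of_nonneg (sin_pos.le.trans sin_ge)]
  calc ‖Real.cos (Real.pi / L * s)‖ / Real.sin (Real.pi / L * s) ≤ 1 / (s / (L / 2)) := by
        gcongr
        exact Real.abs_cos_le_one _
    _ = L / 2 / s := by rw [one_div_div]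

theorem exists_norm_zeta1_ofReal_le (hL : 0 < L) (hδ : 0 < δ) :
    ∃ C : ℝ, ∀ s ∈ Set.Ioc 0 (L / 2), ‖zeta1 L δ (s : ℝ)‖ ≤ C / s := by
  obtain ⟨K, hK, hbound⟩ := exists_norm_zeta1_le hL hδ
  refine ⟨Real.pi / L * (L / 2 + K * (L / 2)), fun s hs ↦ ?_⟩
  refine (hbound s (by simpa using hδ.le)).trans ?_
  rw [mul_div_assoc, add_div]
  have K_le : K ≤ K * (L / 2) / s := by
    rw [le_div_iff₀ hs.1]
    gcongr
    exact hs.2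
  gcongr
  exact norm_cot_mul_le hL hs

theorem exists_norm_zeta1_shifted_le (hL : 0 < L) (hδ : 0 < δ) :
    ∃ C : ℝ, ∀ s : ℝ, ‖zeta1 L δ (s + I * δ)‖ ≤ C := by
  obtain ⟨K, -, hbound⟩ := exists_norm_zeta1_le hL hδ
  refine ⟨Real.pi / L * (1 / (Real.pi / L * δ) ^ 2 + 1 + K), fun s ↦ ?_⟩
  refine (hbound _ (by simp [abs_of_pos hδ])).trans ?_
  set w : ℂ := (Real.pi / L : ℝ) * (s + I * δ) with hw
  have im_w : w.im = Real.pi / L * δ := by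
    rw [hw, im_ofReal_mul]
    simp
  gcongr
  calc ‖cot w‖ ≤ ‖cot w + I‖ + ‖I‖ := by simpa using norm_sub_le (cot w + I) I
    _ ≤ 1 / (Real.pi / L * δ) ^ 2 + 1 := by
        rw [norm_I, ← im_w]
        gcongr
        exact norm_cot_add_I_le (im_w ▸ by positivity)

end Kernel

section PrincipalValue

open MeasureTheory

variable {L : ℝ}

theorem forall_lt_abs_sub_intCast_mul_iff {ε s : ℝ} :
    (∀ m : ℤ, ε < |s - m * L|) ↔ ε < ‖(s : AddCircle L)‖ := by
  refine ⟨fun h ↦ by rw [AddCircle.norm_eq]; exact h _, fun h m ↦ h.trans_le ?_⟩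
  have hm : ((m * L : ℝ) : AddCircle L) = 0 :=
    (AddCircle.coe_eq_zero_iff L).2 ⟨m, zsmul_eq_mul _ _⟩
  calc ‖(s : AddCircle L)‖ = ‖((s - m * L : ℝ) : AddCircle L)‖ := by
        rw [AddCircle.coe_sub, hm, sub_zero]
    _ ≤ |s - m * L| := QuotientAddGroup.norm_mk_le_norm

/-- The kernel `k`, replaced by zero in the closed `ε`-neighbourhood of the lattice `L ℤ`; the
distance to that lattice is the norm on `AddCircle L`. -/
def truncatedKernel (L ε : ℝ) (k : ℝ → ℂ) : ℝ → ℂ :=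
  {s : ℝ | ε < ‖(s : AddCircle L)‖}.indicator k

theorem setIntegral_puncturedPeriod_eq_truncatedKernel (hL : 0 ≤ L) (k f : ℝ → ℂ) (x ε : ℝ) :
    ∫ y in puncturedPeriod L x ε, k (y - x) * f y =
      ∫ y in -(L / 2)..(L / 2), truncatedKernel L ε k (y - x) * f y := by
  have hset : puncturedPeriod L x ε = Set.Ioc (-(L / 2)) (L / 2) ∩
      (fun y : ℝ ↦ y - x) ⁻¹' {s | ε < ‖(s : AddCircle L)‖} := by
    ext y
    exact and_congr_right fun _ ↦ forall_lt_abs_sub_intCast_mul_iff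
  have hmeas : MeasurableSet {s : ℝ | ε < ‖(s : AddCircle L)‖} :=
    (isOpen_lt continuous_const (AddCircle.continuous_mk' L).norm).measurableSet
  rw [hset, ← setIntegral_indicator (hmeas.preimage (measurable_sub_const x)),
    intervalIntegral.integral_of_le (by linarith)]
  refine integral_congr_ae (Eventually.of_forall fun y ↦ ?_)
  simp only [truncatedKernel, Set.indicator, Set.mem_preimage, ite_mul, zero_mul]

/-- An odd `L`-periodic function whose only singularities are simple poles at the points of `L ℤ`:
the kernels for which the principal value integral over a period makes sense. -/
structure IsSimplePoleKernel (L : ℝ) (k : ℝ → ℂ) : Prop where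
  measurable : Measurable k
  odd : ∀ s, k (-s) = -k s
  periodic : Function.Periodic k L
  exists_norm_le : ∃ C : ℝ, ∀ s ∈ Set.Ioc 0 (L / 2), ‖k s‖ ≤ C / s

namespace IsSimplePoleKernel

variable {k f : ℝ → ℂ} {ε : ℝ}

theorem truncated (hk : IsSimplePoleKernel L k) (ε : ℝ) :
    IsSimplePoleKernel L (truncatedKernel L ε k) where
  measurable := hk.measurable.indicator
    (isOpen_lt continuous_const (AddCircle.continuous_mk' L).norm).measurableSet
  odd s := by
    by_cases h : ε < ‖(s : AddCircle L)‖ <;> simp [truncatedKernel, Set.indicator, hk.odd, h]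
  periodic s := by simp [truncatedKernel, Set.indicator, hk.periodic s]
  exists_norm_le := hk.exists_norm_le.imp fun _ hC s hs ↦
    (norm_indicator_le_norm_self _ _).trans (hC s hs)

theorem intervalIntegrable_truncated (hk : IsSimplePoleKernel L k) (hL : 0 ≤ L) (hε : 0 < ε) :
    IntervalIntegrable (truncatedKernel L ε k) volume (-(L / 2)) (L / 2) := by
  obtain ⟨C, hC⟩ := hk.exists_norm_le
  have hbound : ∀ s ∈ Set.Ioc 0 (L / 2), ‖truncatedKernel L ε k s‖ ≤ |C| / ε := by
    intro s hs
    by_cases h : ε < ‖(s : AddCircle L)‖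
    · have hεs : ε ≤ s := by
        simpa [abs_of_pos hs.1] using h.le.trans (QuotientAddGroup.norm_mk_le_norm (m := s))
      calc ‖truncatedKernel L ε k s‖ = ‖k s‖ := by simp [truncatedKernel, Set.indicator, h]
        _ ≤ C / s := hC s hs
        _ ≤ |C| / ε := by gcongr; exact le_abs_self C
    · simpa [truncatedKernel, Set.indicator, h] using by positivity
  have right : IntervalIntegrable (truncatedKernel L ε k) volume 0 (L / 2) := by
    refine (intervalIntegrable_const (c := |C| / ε)).mono_fun'
      (hk.truncated ε).measurable.aestronglyMeasurable ?_
    rw [Set.uIoc_of_le (by linarith)]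
    exact ae_restrict_of_forall_mem measurableSet_Ioc hbound
  have left : IntervalIntegrable (truncatedKernel L ε k) volume (-(L / 2)) 0 := by
    rw [IntervalIntegrable.iff_comp_neg]
    simpa only [(hk.truncated ε).odd, neg_neg, neg_zero] using! right.symm.neg
  exact left.trans right

end IsSimplePoleKernel

theorem intervalIntegral_neg_self_eq {E : Type*} [NormedAddCommGroup E] [NormedSpace ℝ E]
    {g : ℝ → E} {a : ℝ} (hg : IntervalIntegrable g volume (-a) a) :
    ∫ s in -a..a, g s = ∫ s in 0..a, (g s + g (-s)) := by
  have h0 : (0 : ℝ) ∈ Set.uIcc (-a) a := by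
    rcases le_total 0 a with h | h
    · exact Set.mem_uIcc_of_le (by linarith) h
    · exact Set.mem_uIcc_of_ge h (by linarith)
  have left : IntervalIntegrable g volume (-a) 0 :=
    hg.mono_set (Set.uIcc_subset_uIcc Set.left_mem_uIcc h0)
  have right : IntervalIntegrable g volume 0 a :=
    hg.mono_set (Set.uIcc_subset_uIcc h0 Set.right_mem_uIcc)
  have left' : IntervalIntegrable (fun s ↦ g (-s)) volume 0 a := by
    simpa using ((IntervalIntegrable.iff_comp_neg (by simp)).1 left).symm
  rw [intervalIntegral.integral_add right left', intervalIntegral.integral_comp_neg, neg_zero,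
    add_comm, intervalIntegral.integral_add_adjacent_intervals left right]

theorem intervalIntegral_comp_const_add_of_periodic {E : Type*} [NormedAddCommGroup E]
    [NormedSpace ℝ E] {h : ℝ → E} (hh : Function.Periodic h L) (x : ℝ) :
    ∫ s in -(L / 2)..(L / 2), h (x + s) = ∫ y in -(L / 2)..(L / 2), h y := by
  have shift := hh.intervalIntegral_add_eq (x + -(L / 2)) (-(L / 2))
  rwa [show x + -(L / 2) + L = x + L / 2 by ring, show -(L / 2) + L = L / 2 by ring,
    ← intervalIntegral.integral_comp_add_left] at shift

theorem exists_norm_le_of_periodic {E : Type*} [SeminormedAddCommGroup E] {f : ℝ → E}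
    (hL : L ≠ 0) (hf : Continuous f) (hp : Function.Periodic f L) :
    ∃ B : ℝ, ∀ x, ‖f x‖ ≤ B := by
  obtain ⟨B, hB⟩ := (hp.isBounded_of_continuous hL hf).exists_norm_le
  exact ⟨B, fun x ↦ hB _ ⟨x, rfl⟩⟩

theorem periodic_deriv {E : Type*} [NormedAddCommGroup E] [NormedSpace ℝ E] {f : ℝ → E}
    (hp : Function.Periodic f L) : Function.Periodic (deriv f) L := fun x ↦ by
  rw [← deriv_comp_add_const, funext hp]

theorem exists_norm_add_sub_sub_le {E : Type*} [NormedAddCommGroup E] [NormedSpace ℝ E]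
    {f : ℝ → E} (hL : L ≠ 0) (hf : ContDiff ℝ 1 f) (hp : Function.Periodic f L) :
    ∃ B : ℝ, ∀ x s : ℝ, 0 ≤ s → ‖f (x + s) - f (x - s)‖ ≤ B * s := by
  obtain ⟨B, hB⟩ := exists_norm_le_of_periodic hL hf.continuous_deriv_one (periodic_deriv hp)
  refine ⟨B * 2, fun x s hs ↦ ?_⟩
  calc ‖f (x + s) - f (x - s)‖ ≤ B * ‖x + s - (x - s)‖ :=
        convex_univ.norm_image_sub_le_of_norm_deriv_le (𝕜 := ℝ)
          (fun y _ ↦ hf.differentiable (by simp) y) (fun y _ ↦ hB y) trivial trivial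
    _ = B * 2 * s := by
        rw [show x + s - (x - s) = 2 * s by ring, Real.norm_of_nonneg (by positivity), mul_assoc]

theorem norm_mul_le_of_le_div {C B s : ℝ} {z w : ℂ} (hs : 0 < s) (hz : ‖z‖ ≤ C / s)
    (hw : ‖w‖ ≤ B * s) : ‖z * w‖ ≤ C * B := by
  calc ‖z * w‖ = ‖z‖ * ‖w‖ := norm_mul z w
    _ ≤ C / s * (B * s) := mul_le_mul hz hw (norm_nonneg w) ((norm_nonneg z).trans hz)
    _ = C * B := by field_simp

theorem hasDerivAt_intervalIntegral_mul {a b B B' : ℝ} {k : ℝ → ℂ} {g g' : ℝ → ℝ → ℂ}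
    (hk : Measurable k) (hg : ∀ x, Measurable (g x)) (hg' : ∀ x, Measurable (g' x))
    (hderiv : ∀ x s, HasDerivAt (g · s) (g' x s) x)
    (hB : ∀ x, ∀ s ∈ Set.uIoc a b, ‖k s * g x s‖ ≤ B)
    (hB' : ∀ x, ∀ s ∈ Set.uIoc a b, ‖k s * g' x s‖ ≤ B') (x : ℝ) :
    HasDerivAt (fun x ↦ ∫ s in a..b, k s * g x s) (∫ s in a..b, k s * g' x s) x := by
  refine (intervalIntegral.hasDerivAt_integral_of_dominated_loc_of_deriv_le
    (bound := fun _ ↦ B') univ_mem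
    (Eventually.of_forall fun y ↦ (hk.mul (hg y)).aestronglyMeasurable) ?_
    (hk.mul (hg' x)).aestronglyMeasurable (Eventually.of_forall fun s hs y _ ↦ hB' y s hs)
    intervalIntegrable_const
    (Eventually.of_forall fun s _ y _ ↦ (hderiv y s).const_mul (k s))).2
  exact (intervalIntegrable_const (c := B)).mono_fun' (hk.mul (hg x)).aestronglyMeasurable
    (ae_restrict_of_forall_mem measurableSet_uIoc (hB x))

namespace IsSimplePoleKernel

variable {k f : ℝ → ℂ} {ε : ℝ}

theorem setIntegral_puncturedPeriod (hk : IsSimplePoleKernel L k) (hL : 0 ≤ L) (hε : 0 < ε)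
    (hf : Continuous f) (hp : Function.Periodic f L) (x : ℝ) :
    ∫ y in puncturedPeriod L x ε, k (y - x) * f y =
      ∫ s in 0..(L / 2), truncatedKernel L ε k s * (f (x + s) - f (x - s)) := by
  have hper : Function.Periodic (fun y ↦ truncatedKernel L ε k (y - x) * f y) L := fun y ↦ by
    simp only [hp y, add_sub_right_comm, (hk.truncated ε).periodic (y - x)]
  have hkf : IntervalIntegrable (fun s ↦ truncatedKernel L ε k s * f (x + s)) volume
      (-(L / 2)) (L / 2) :=
    (hk.intervalIntegrable_truncated hL hε).mul_continuousOn
      (hf.comp (continuous_const_add x)).continuousOn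
  calc ∫ y in puncturedPeriod L x ε, k (y - x) * f y
      = ∫ y in -(L / 2)..(L / 2), truncatedKernel L ε k (y - x) * f y :=
        setIntegral_puncturedPeriod_eq_truncatedKernel hL k f x ε
    _ = ∫ s in -(L / 2)..(L / 2), truncatedKernel L ε k s * f (x + s) := by
        rw [← intervalIntegral_comp_const_add_of_periodic hper x]
        simp only [add_sub_cancel_left]
    _ = _ := by
        rw [intervalIntegral_neg_self_eq hkf]
        refine intervalIntegral.integral_congr fun s _ ↦ ?_
        simp only [(hk.truncated ε).odd, ← sub_eq_add_neg]
        ring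

/-- Oddness of `k` leaves a symmetric difference of `f`, which compensates the pole at `0`. -/
theorem tendsto_setIntegral_puncturedPeriod (hk : IsSimplePoleKernel L k) (hL : 0 < L)
    (hf : ContDiff ℝ 1 f) (hp : Function.Periodic f L) (x : ℝ) :
    Tendsto (fun ε ↦ ∫ y in puncturedPeriod L x ε, k (y - x) * f y) (𝓝[>] 0)
      (𝓝 (∫ s in 0..(L / 2), k s * (f (x + s) - f (x - s)))) := by
  obtain ⟨C, hC⟩ := hk.exists_norm_le
  obtain ⟨B, hB⟩ := exists_norm_add_sub_sub_le hL.ne' hf hp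
  have hfc := hf.continuous
  have huIoc : Set.uIoc 0 (L / 2) = Set.Ioc 0 (L / 2) := Set.uIoc_of_le (by linarith)
  refine Tendsto.congr' (eventually_nhdsWithin_of_forall fun ε hε ↦
    (hk.setIntegral_puncturedPeriod hL.le hε hfc hp x).symm) ?_
  refine intervalIntegral.tendsto_integral_filter_of_dominated_convergence (fun _ ↦ C * B)
    (Eventually.of_forall fun ε ↦
      ((hk.truncated ε).measurable.mul (by fun_prop)).aestronglyMeasurable)
    (Eventually.of_forall fun ε ↦ Eventually.of_forall fun s hs ↦ ?_) intervalIntegrable_const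
    (Eventually.of_forall fun s hs ↦ tendsto_const_nhds.congr' ?_)
  · rw [huIoc] at hs
    exact norm_mul_le_of_le_div hs.1 ((norm_indicator_le_norm_self _ _).trans (hC s hs))
      (hB x s hs.1.le)
  · rw [huIoc] at hs
    have hnorm : ‖(s : AddCircle L)‖ = s := by
      simpa [abs_of_pos hs.1, abs_of_pos hL, hs.2] using
        (AddCircle.norm_coe_eq_abs_iff L (x := s) hL.ne').2
    filter_upwards [mem_nhdsWithin_of_mem_nhds (Iio_mem_nhds hs.1)] with ε hε
    rw [truncatedKernel, Set.indicator_of_mem (by simpa [hnorm] using hε)]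

theorem hasDerivAt_integral_symmetricDifference (hk : IsSimplePoleKernel L k) (hL : 0 < L)
    (hf : ContDiff ℝ 2 f) (hp : Function.Periodic f L) (x : ℝ) :
    HasDerivAt (fun x ↦ ∫ s in 0..(L / 2), k s * (f (x + s) - f (x - s)))
      (∫ s in 0..(L / 2), k s * (deriv f (x + s) - deriv f (x - s))) x := by
  obtain ⟨C, hC⟩ := hk.exists_norm_le
  have hf₁ : ContDiff ℝ 1 f := hf.of_le (by norm_num)
  have hf' : ContDiff ℝ 1 (deriv f) := ContDiff.deriv' (by rwa [one_add_one_eq_two])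
  obtain ⟨B, hB⟩ := exists_norm_add_sub_sub_le hL.ne' hf₁ hp
  obtain ⟨B', hB'⟩ := exists_norm_add_sub_sub_le hL.ne' hf' (periodic_deriv hp)
  have hfc := hf.continuous
  have hfc' := hf'.continuous
  have hderiv (y : ℝ) : HasDerivAt f (deriv f y) y :=
    (hf₁.differentiable (by simp) y).hasDerivAt
  have huIoc : Set.uIoc 0 (L / 2) = Set.Ioc 0 (L / 2) := Set.uIoc_of_le (by linarith)
  rw [← huIoc] at hC
  have pos {s : ℝ} (hs : s ∈ Set.uIoc 0 (L / 2)) : 0 < s := by rw [huIoc] at hs; exact hs.1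
  exact hasDerivAt_intervalIntegral_mul hk.measurable (fun _ ↦ by fun_prop) (fun _ ↦ by fun_prop)
    (fun y s ↦ ((hderiv (y + s)).comp_add_const y s).sub ((hderiv (y - s)).comp_sub_const y s))
    (fun y s hs ↦ norm_mul_le_of_le_div (pos hs) (hC s hs) (hB y s (pos hs).le))
    (fun y s hs ↦ norm_mul_le_of_le_div (pos hs) (hC s hs) (hB' y s (pos hs).le)) x

end IsSimplePoleKernel

end PrincipalValue

section Operators

variable {L δ : ℝ} {f : ℝ → ℂ}

theorem isSimplePoleKernel_zeta1 (hL : 0 < L) (hδ : 0 < δ) :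
    IsSimplePoleKernel L fun s ↦ zeta1 L δ (s : ℝ) where
  measurable := (measurable_zeta1 hL hδ).comp Complex.measurable_ofReal
  odd s := by rw [Complex.ofReal_neg, zeta1_neg hL hδ]
  periodic s := by simp only [Complex.ofReal_add, zeta1_add_period hL.ne']
  exists_norm_le := exists_norm_zeta1_ofReal_le hL hδ

theorem opT_eq_integral (hL : 0 < L) (hδ : 0 < δ) (hf : ContDiff ℝ 1 f)
    (hp : Function.Periodic f L) (x : ℝ) :
    opT L δ f x = (1 / Real.pi : ℝ) *
      ∫ s in 0..(L / 2), zeta1 L δ (s : ℝ) * (f (x + s) - f (x - s)) := by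
  rw [opT, ((isSimplePoleKernel_zeta1 hL hδ).tendsto_setIntegral_puncturedPeriod
    hL hf hp x).limUnder_eq]

theorem opTt_eq_integral (hL : L ≠ 0) (hp : Function.Periodic f L) (x : ℝ) :
    opTt L δ f x = (1 / Real.pi : ℝ) *
      ∫ s in -(L / 2)..(L / 2), zeta1 L δ (s + Complex.I * δ) * f (x + s) := by
  have hper : Function.Periodic
      (fun y : ℝ ↦ zeta1 L δ ((y - x : ℝ) + Complex.I * δ) * f y) L := fun y ↦ by
    have shift : ((y + L - x : ℝ) + Complex.I * δ : ℂ) = (y - x : ℝ) + Complex.I * δ + L := by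
      push_cast
      ring
    simp only [shift, zeta1_add_period hL, hp y]
  rw [opTt, ← intervalIntegral_comp_const_add_of_periodic hper x]
  simp only [add_sub_cancel_left]

theorem hasDerivAt_opT (hL : 0 < L) (hδ : 0 < δ) (hf : ContDiff ℝ 2 f)
    (hp : Function.Periodic f L) (x : ℝ) :
    HasDerivAt (opT L δ f) (opT L δ (deriv f) x) x := by
  have hf' : ContDiff ℝ 1 (deriv f) := ContDiff.deriv' (by rwa [one_add_one_eq_two])
  rw [funext (opT_eq_integral hL hδ (hf.of_le one_le_two) hp),
    opT_eq_integral hL hδ hf' (periodic_deriv hp)]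
  exact ((isSimplePoleKernel_zeta1 hL hδ).hasDerivAt_integral_symmetricDifference
    hL hf hp x).const_mul _

theorem hasDerivAt_opTt (hL : 0 < L) (hδ : 0 < δ) (hf : ContDiff ℝ 1 f)
    (hp : Function.Periodic f L) (x : ℝ) :
    HasDerivAt (opTt L δ f) (opTt L δ (deriv f) x) x := by
  obtain ⟨C, hC⟩ := exists_norm_zeta1_shifted_le hL hδ
  obtain ⟨B, hB⟩ := exists_norm_le_of_periodic hL.ne' hf.continuous hp
  obtain ⟨B', hB'⟩ :=
    exists_norm_le_of_periodic hL.ne' hf.continuous_deriv_one (periodic_deriv hp)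
  have hfc := hf.continuous
  have hk : Measurable fun s : ℝ ↦ zeta1 L δ (s + Complex.I * δ) :=
    (measurable_zeta1 hL hδ).comp (by fun_prop)
  rw [funext (opTt_eq_integral hL.ne' hp), opTt_eq_integral hL.ne' (periodic_deriv hp)]
  exact (hasDerivAt_intervalIntegral_mul (g := fun x s ↦ f (x + s))
    (g' := fun x s ↦ deriv f (x + s)) hk (fun _ ↦ by fun_prop) (fun _ ↦ by fun_prop)
    (fun y s ↦ (hf.differentiable (by simp) (y + s)).hasDerivAt.comp_add_const y s)
    (fun y s _ ↦ norm_mul_le_of_le (hC s) (hB (y + s)))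
    (fun y s _ ↦ norm_mul_le_of_le (hC s) (hB' (y + s))) x).const_mul _

theorem contDiff_infty_of_hasDerivAt_commute {𝕜 E : Type*} [NontriviallyNormedField 𝕜]
    [NormedAddCommGroup E] [NormedSpace 𝕜 E] {P : (𝕜 → E) → Prop} {S : (𝕜 → E) → 𝕜 → E}
    (hP : ∀ f, P f → P (deriv f)) (hS : ∀ f, P f → ∀ x, HasDerivAt (S f) (S (deriv f) x) x)
    {f : 𝕜 → E} (hf : P f) : ContDiff 𝕜 ∞ (S f) := by
  refine contDiff_infty.2 fun n ↦ ?_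
  induction n generalizing f with
  | zero =>
    exact contDiff_zero.2 (continuous_iff_continuousAt.2 fun x ↦ (hS f hf x).continuousAt)
  | succ n ih =>
    push_cast
    refine contDiff_succ_iff_deriv.2 ⟨fun x ↦ (hS f hf x).differentiableAt, by simp, ?_⟩
    rw [funext fun x ↦ (hS f hf x).deriv]
    exact ih (hP f hf)

/-- Smooth `L`-periodic functions on the line, the common domain on which `T` and `T̃` act. -/
structure SmoothPeriodic (L : ℝ) (f : ℝ → ℂ) : Prop where
  contDiff : ContDiff ℝ ∞ f
  periodic : Function.Periodic f L

namespace SmoothPeriodic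

theorem deriv (hf : SmoothPeriodic L f) : SmoothPeriodic L (deriv f) :=
  ⟨(contDiff_infty_iff_deriv.1 hf.contDiff).2, periodic_deriv hf.periodic⟩

theorem hasDerivAt_opT (hf : SmoothPeriodic L f) (hL : 0 < L) (hδ : 0 < δ) (x : ℝ) :
    HasDerivAt (opT L δ f) (opT L δ (_root_.deriv f) x) x :=
  NcILW.hasDerivAt_opT hL hδ (contDiff_infty.1 hf.contDiff 2) hf.periodic x

theorem hasDerivAt_opTt (hf : SmoothPeriodic L f) (hL : 0 < L) (hδ : 0 < δ) (x : ℝ) :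
    HasDerivAt (opTt L δ f) (opTt L δ (_root_.deriv f) x) x :=
  NcILW.hasDerivAt_opTt hL hδ (contDiff_infty.1 hf.contDiff 1) hf.periodic x

theorem opT (hf : SmoothPeriodic L f) (hL : 0 < L) (hδ : 0 < δ) :
    SmoothPeriodic L (opT L δ f) where
  contDiff := contDiff_infty_of_hasDerivAt_commute (fun _ h ↦ h.deriv)
    (fun _ h ↦ h.hasDerivAt_opT hL hδ) hf
  periodic x := by
    simp only [opT_eq_integral hL hδ (contDiff_infty.1 hf.contDiff 1) hf.periodic,
      add_right_comm x L, add_sub_right_comm x L, hf.periodic _]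

theorem opTt (hf : SmoothPeriodic L f) (hL : 0 < L) (hδ : 0 < δ) :
    SmoothPeriodic L (opTt L δ f) where
  contDiff := contDiff_infty_of_hasDerivAt_commute (fun _ h ↦ h.deriv)
    (fun _ h ↦ h.hasDerivAt_opTt hL hδ) hf
  periodic x := by
    simp only [opTt_eq_integral hL.ne' hf.periodic, add_right_comm x L, hf.periodic _]

end SmoothPeriodic

end Operators

section PartialDerivatives

variable {L : ℝ} {f : ℝ → ℝ → ℂ}

namespace Smooth

theorem contDiff_x (hf : Smooth f) (t : ℝ) : ContDiff ℝ ∞ fun x ↦ f x t :=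
  ContDiff.comp (g := fun p : ℝ × ℝ ↦ f p.1 p.2) hf (contDiff_prodMk_left t)

theorem contDiff_t (hf : Smooth f) (x : ℝ) : ContDiff ℝ ∞ (f x) :=
  ContDiff.comp (g := fun p : ℝ × ℝ ↦ f p.1 p.2) hf (contDiff_prodMk_right x)

theorem hasDerivAt_x (hf : Smooth f) (x t : ℝ) : HasDerivAt (fun y ↦ f y t) (dx f x t) x :=
  ((hf.contDiff_x t).differentiable (by simp) x).hasDerivAt

theorem hasDerivAt_t (hf : Smooth f) (x t : ℝ) : HasDerivAt (f x) (dt f x t) t :=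
  ((hf.contDiff_t x).differentiable (by simp) t).hasDerivAt

theorem dx_eq_fderiv (hf : Smooth f) (x t : ℝ) :
    dx f x t = fderiv ℝ (fun p : ℝ × ℝ ↦ f p.1 p.2) (x, t) (1, 0) := by
  have hfd := (ContDiff.differentiable hf (by simp) (x, t)).hasFDerivAt
  exact (hfd.comp_hasDerivAt x ((hasDerivAt_id x).prodMk (hasDerivAt_const x t))).deriv

theorem dt_eq_fderiv (hf : Smooth f) (x t : ℝ) :
    dt f x t = fderiv ℝ (fun p : ℝ × ℝ ↦ f p.1 p.2) (x, t) (0, 1) := by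
  have hfd := (ContDiff.differentiable hf (by simp) (x, t)).hasFDerivAt
  exact (hfd.comp_hasDerivAt t ((hasDerivAt_const t x).prodMk (hasDerivAt_id t))).deriv

theorem contDiff_fderiv (hf : Smooth f) : ContDiff ℝ ∞ (fderiv ℝ fun p : ℝ × ℝ ↦ f p.1 p.2) :=
  (contDiff_infty_iff_fderiv.1 hf).2

theorem dx (hf : Smooth f) : Smooth (dx f) := by
  simp only [Smooth, hf.dx_eq_fderiv]
  exact hf.contDiff_fderiv.clm_apply contDiff_const

theorem dt (hf : Smooth f) : Smooth (dt f) := by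
  simp only [Smooth, hf.dt_eq_fderiv]
  exact hf.contDiff_fderiv.clm_apply contDiff_const

theorem dt_dx (hf : Smooth f) (x t : ℝ) :
    NcILW.dt (NcILW.dx f) x t = NcILW.dx (NcILW.dt f) x t := by
  have hd := hf.contDiff_fderiv.differentiable (by simp) (x, t)
  have symm : IsSymmSndFDerivAt ℝ (fun p : ℝ × ℝ ↦ f p.1 p.2) (x, t) :=
    (ContDiff.contDiffAt hf).isSymmSndFDerivAt
      (by simpa using WithTop.coe_le_coe.2 (le_top (a := (2 : ℕ∞))))
  rw [hf.dx.dt_eq_fderiv, hf.dt.dx_eq_fderiv]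
  simp only [hf.dx_eq_fderiv, hf.dt_eq_fderiv,
    fderiv_clm_apply hd (differentiableAt_const _), fderiv_fun_const, Pi.zero_apply,
    ContinuousLinearMap.comp_zero, zero_add, ContinuousLinearMap.flip_apply]
  exact symm.eq _ _

theorem neg (hf : Smooth f) : Smooth (-f) := ContDiff.neg hf

end Smooth

theorem dx_neg (f : ℝ → ℝ → ℂ) : dx (-f) = -dx f := by
  ext x t
  exact deriv.fun_neg

theorem dt_neg (f : ℝ → ℝ → ℂ) : dt (-f) = -dt f := by
  ext x t
  exact deriv.fun_neg

theorem dx_eq_zero {t : ℝ} (hf : ∀ x, f x t = 0) (x : ℝ) : dx f x t = 0 := by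
  rw [dx, funext hf, deriv_const]

/-- Smooth functions of `(x, t)` that are `L`-periodic in `x`: the class in which `u` and `v`
are taken. -/
structure SmoothXPeriodic (L : ℝ) (f : ℝ → ℝ → ℂ) : Prop where
  smooth : Smooth f
  periodic : XPeriodic L f

namespace SmoothXPeriodic

theorem dx (hf : SmoothXPeriodic L f) : SmoothXPeriodic L (dx f) :=
  ⟨hf.smooth.dx, fun x t ↦ periodic_deriv (fun y ↦ hf.periodic y t) x⟩

theorem neg (hf : SmoothXPeriodic L f) : SmoothXPeriodic L (-f) :=
  ⟨hf.smooth.neg, fun x t ↦ congrArg Neg.neg (hf.periodic x t)⟩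

theorem smoothPeriodic (hf : SmoothXPeriodic L f) (t : ℝ) : SmoothPeriodic L fun x ↦ f x t :=
  ⟨hf.smooth.contDiff_x t, fun x ↦ hf.periodic x t⟩

end SmoothXPeriodic

end PartialDerivatives

section Commutator

open Complex

/-- The operator `i ∂ₓ - q - μ` of the `x`-part on one contour: `q = u` on `Π₀` and `q = -v` on
`Π_δ`. -/
def xOp (q : ℝ → ℝ → ℂ) (μ : ℂ) (φ : ℝ → ℝ → ℂ) (x t : ℝ) : ℂ :=
  I * dx φ x t + (-q x t - μ) * φ x t

/-- The operator `∂ₜ + i ∂ₓ² - 2μ ∂ₓ - i c` of the `t`-part. -/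
def tOp (μ : ℂ) (c φ : ℝ → ℝ → ℂ) (x t : ℝ) : ℂ :=
  dt φ x t + I * dx (dx φ) x t - 2 * μ * dx φ x t - I * c x t * φ x t

/-- The left-hand side of `q_t + 2 q q_x + W_x = 0`. Both equations of the ncILW system have this
form, with `(q, W) = (u, T u_x + T̃ v_x)` and `(q, W) = (-v, T v_x + T̃ u_x)`. -/
def burgersDefect (q W : ℝ → ℝ → ℂ) (x t : ℝ) : ℂ :=
  dt q x t + 2 * q x t * dx q x t + dx W x t

variable {q W c φ χ : ℝ → ℝ → ℂ} {μ ν : ℂ} {x t : ℝ}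

theorem Smooth.xOp (hq : Smooth q) (hφ : Smooth φ) (μ : ℂ) : Smooth (xOp q μ φ) := by
  have hφx := hφ.dx
  unfold Smooth NcILW.xOp at *
  fun_prop

theorem dt_xOp (hq : Smooth q) (hφ : Smooth φ) :
    dt (xOp q μ φ) x t = xOp q μ (dt φ) x t - dt q x t * φ x t := by
  have h := ((hφ.dx.hasDerivAt_t x t).const_mul I).add
    (((hq.hasDerivAt_t x t).neg.sub_const μ).mul (hφ.hasDerivAt_t x t))
  refine h.deriv.trans ?_
  rw [hφ.dt_dx, xOp, Pi.neg_apply]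
  ring

theorem dx_xOp (hq : Smooth q) (hφ : Smooth φ) :
    dx (xOp q μ φ) x t = xOp q μ (dx φ) x t - dx q x t * φ x t := by
  have h := ((hφ.dx.hasDerivAt_x x t).const_mul I).add
    (((hq.hasDerivAt_x x t).neg.sub_const μ).mul (hφ.hasDerivAt_x x t))
  refine h.deriv.trans ?_
  rw [xOp, Pi.neg_apply]
  ring

theorem dx_dx_xOp (hq : Smooth q) (hφ : Smooth φ) :
    dx (dx (xOp q μ φ)) x t =
      xOp q μ (dx (dx φ)) x t - 2 * dx q x t * dx φ x t - dx (dx q) x t * φ x t := by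
  have hdx : dx (xOp q μ φ) = fun x t ↦ xOp q μ (dx φ) x t - dx q x t * φ x t :=
    funext₂ fun _ _ ↦ dx_xOp hq hφ
  have h := ((hq.xOp hφ.dx μ).hasDerivAt_x x t).sub
    ((hq.dx.hasDerivAt_x x t).mul (hφ.hasDerivAt_x x t))
  rw [hdx]
  refine h.deriv.trans ?_
  rw [dx_xOp hq hφ.dx]
  ring

theorem dx_tOp (hφ : Smooth φ) (hc : DifferentiableAt ℝ (fun x ↦ c x t) x) :
    dx (tOp μ c φ) x t = tOp μ c (dx φ) x t - I * dx c x t * φ x t := by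
  have h := (((hφ.dt.hasDerivAt_x x t).add ((hφ.dx.dx.hasDerivAt_x x t).const_mul I)).sub
    ((hφ.dx.hasDerivAt_x x t).const_mul (2 * μ))).sub
      ((hc.hasDerivAt.const_mul I).mul (hφ.hasDerivAt_x x t))
  refine h.deriv.trans ?_
  rw [← hφ.dt_dx, tOp, dx.eq_def c]
  ring

theorem tOp_sub_const_mul (hφ : Smooth φ) (hχ : Smooth χ) :
    tOp μ c (fun x t ↦ φ x t - ν * χ x t) x t = tOp μ c φ x t - ν * tOp μ c χ x t := by
  have hdx {φ χ : ℝ → ℝ → ℂ} (hφ : Smooth φ) (hχ : Smooth χ) :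
      dx (fun x t ↦ φ x t - ν * χ x t) = fun x t ↦ dx φ x t - ν * dx χ x t :=
    funext₂ fun x t ↦ ((hφ.hasDerivAt_x x t).sub ((hχ.hasDerivAt_x x t).const_mul ν)).deriv
  have hdt : dt (fun x t ↦ φ x t - ν * χ x t) x t = dt φ x t - ν * dt χ x t :=
    ((hφ.hasDerivAt_t x t).sub ((hχ.hasDerivAt_t x t).const_mul ν)).deriv
  simp only [tOp, hdt, hdx hφ hχ, hdx hφ.dx hχ.dx]
  ring

theorem xOp_eq_zero (hφ : ∀ x, φ x t = 0) (x : ℝ) : xOp q μ φ x t = 0 := by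
  simp [xOp, dx_eq_zero hφ, hφ]

theorem tOp_eq_dt (hφ : ∀ x, φ x t = 0) (x : ℝ) : tOp μ c φ x t = dt φ x t := by
  simp [tOp, dx_eq_zero (dx_eq_zero hφ), dx_eq_zero hφ, hφ]

/-- The `ψ⁺` and `ψ⁻` operators of the `t`-part differ by `2 q_x`, which cancels the first order
part `-2i q_x ∂ₓ` of `[i ∂ₓ², i ∂ₓ - q - μ]`: only a multiplication operator is left. -/
theorem tOp_xOp (hq : Smooth q) (hφ : Smooth φ) (hW : DifferentiableAt ℝ (fun x ↦ W x t) x) :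
    tOp μ (fun x t ↦ W x t + I * dx q x t) (xOp q μ φ) x t =
      xOp q μ (tOp μ (fun x t ↦ W x t - I * dx q x t) φ) x t -
        burgersDefect q W x t * φ x t := by
  have hqx := hq.dx.hasDerivAt_x x t
  have hdc : dx (fun x t ↦ W x t - I * dx q x t) x t = dx W x t - I * dx (dx q) x t :=
    (hW.hasDerivAt.sub (hqx.const_mul I)).deriv
  have hc : DifferentiableAt ℝ (fun x ↦ W x t - I * dx q x t) x :=
    hW.sub (hqx.differentiableAt.const_mul I)
  rw [tOp, dt_xOp hq hφ, dx_dx_xOp hq hφ, dx_xOp hq hφ, xOp.eq_def q μ (tOp _ _ _),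
    dx_tOp hφ hc, hdc]
  simp only [tOp, xOp, burgersDefect, hφ.dt_dx]
  linear_combination (φ x t * dx W x t + 2 * (q x t + μ) * φ x t * dx q x t
    - I * φ x t * dx (dx q) x t - 2 * I * dx q x t * dx φ x t) * I_sq

/-- The Lax pair on one contour, at time `t`, for smooth functions `φ`, `χ` of `(x, t)`. It covers
both contours: `φ` is the boundary value that is differentiated in the `x`-part (`ψ⁻` on `Π₀`,
`ψ⁺` on `Π_δ`) and `χ` is the other one. -/
structure SatisfiesLaxPair (q W : ℝ → ℝ → ℂ) (μ ν : ℂ) (φ χ : ℝ → ℝ → ℂ) (t : ℝ) : Prop where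
  smooth_left : Smooth φ
  smooth_right : Smooth χ
  xPart : ∀ x, xOp q μ φ x t - ν * χ x t = 0
  tPart_left : ∀ x, tOp μ (fun x t ↦ W x t - I * dx q x t) φ x t = 0
  tPart_right : ∀ x, tOp μ (fun x t ↦ W x t + I * dx q x t) χ x t = 0

theorem SatisfiesLaxPair.dt_xDefect (h : SatisfiesLaxPair q W μ ν φ χ t) (hq : Smooth q)
    (hW : DifferentiableAt ℝ (fun x ↦ W x t) x) :
    dt (fun x t ↦ xOp q μ φ x t - ν * χ x t) x t = -(burgersDefect q W x t * φ x t) := by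
  set cRight : ℝ → ℝ → ℂ := fun x t ↦ W x t + I * dx q x t
  calc dt (fun x t ↦ xOp q μ φ x t - ν * χ x t) x t
      = tOp μ cRight (fun x t ↦ xOp q μ φ x t - ν * χ x t) x t := (tOp_eq_dt h.xPart x).symm
    _ = tOp μ cRight (xOp q μ φ) x t := by
        rw [tOp_sub_const_mul (hq.xOp h.smooth_left μ) h.smooth_right, h.tPart_right, mul_zero,
          sub_zero]
    _ = -(burgersDefect q W x t * φ x t) := by
        rw [tOp_xOp hq h.smooth_left hW, xOp_eq_zero h.tPart_left, zero_sub]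

end Commutator

section InitialData

open Complex Function

variable {L : ℝ} {q W c : ℝ → ℝ → ℂ} {a b : ℝ → ℂ} {μ ν : ℂ} {t₀ : ℝ}

/-- The solution to first order in `t - t₀` of the `t`-part with initial value `a` at `t = t₀`. -/
def evolvedFrom (μ : ℂ) (c : ℝ → ℝ → ℂ) (a : ℝ → ℂ) (t₀ x t : ℝ) : ℂ :=
  a x + (t - t₀ : ℝ) * (-I * deriv (deriv a) x + 2 * μ * deriv a x + I * c x t₀ * a x)

theorem evolvedFrom_self (x : ℝ) : evolvedFrom μ c a t₀ x t₀ = a x := by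
  simp [evolvedFrom]

theorem dx_evolvedFrom_self (x : ℝ) : dx (evolvedFrom μ c a t₀) x t₀ = deriv a x := by
  simp only [dx, evolvedFrom_self]

theorem smooth_evolvedFrom (hc : ContDiff ℝ ∞ fun x ↦ c x t₀) (ha : ContDiff ℝ ∞ a) :
    Smooth (evolvedFrom μ c a t₀) := by
  have ha' := (contDiff_infty_iff_deriv.1 ha).2
  have ha'' := (contDiff_infty_iff_deriv.1 ha').2
  have htime : ContDiff ℝ ∞ fun p : ℝ × ℝ ↦ ((p.2 - t₀ : ℝ) : ℂ) :=
    ofRealCLM.contDiff.comp (contDiff_snd.sub contDiff_const)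
  have hrate : ContDiff ℝ ∞ fun x ↦
      -I * deriv (deriv a) x + 2 * μ * deriv a x + I * c x t₀ * a x :=
    ((contDiff_const.mul ha'').add (contDiff_const.mul ha')).add ((contDiff_const.mul hc).mul ha)
  exact (ha.comp contDiff_fst).add (htime.mul (hrate.comp contDiff_fst))

theorem xPeriodic_evolvedFrom (hc : Periodic (fun x ↦ c x t₀) L) (ha : Periodic a L) :
    XPeriodic L (evolvedFrom μ c a t₀) := fun x t ↦ by
  simp only [evolvedFrom, ha x, hc x, periodic_deriv ha x, periodic_deriv (periodic_deriv ha) x]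

theorem tOp_evolvedFrom (x : ℝ) : tOp μ c (evolvedFrom μ c a t₀) x t₀ = 0 := by
  have hdt : dt (evolvedFrom μ c a t₀) x t₀ =
      -I * deriv (deriv a) x + 2 * μ * deriv a x + I * c x t₀ * a x := by
    have htime : HasDerivAt (fun t : ℝ ↦ ((t - t₀ : ℝ) : ℂ)) (1 : ℂ) t₀ := by
      simpa using ((hasDerivAt_id t₀).sub_const t₀).ofReal_comp
    exact ((htime.mul_const _).const_add (a x)).deriv.trans (one_mul _)
  have hdxx : dx (dx (evolvedFrom μ c a t₀)) x t₀ = deriv (deriv a) x := by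
    rw [dx, funext dx_evolvedFrom_self]
  rw [tOp, hdt, hdxx, dx_evolvedFrom_self, evolvedFrom_self]
  ring

theorem satisfiesLaxPair_evolvedFrom (hq : Smooth q) (hW : ContDiff ℝ ∞ fun x ↦ W x t₀)
    (ha : ContDiff ℝ ∞ a) (hb : ContDiff ℝ ∞ b)
    (hab : ∀ x, I * deriv a x + (-q x t₀ - μ) * a x = ν * b x) :
    SatisfiesLaxPair q W μ ν (evolvedFrom μ (fun x t ↦ W x t - I * dx q x t) a t₀)
      (evolvedFrom μ (fun x t ↦ W x t + I * dx q x t) b t₀) t₀ where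
  smooth_left := smooth_evolvedFrom (hW.sub (contDiff_const.mul (hq.dx.contDiff_x t₀))) ha
  smooth_right := smooth_evolvedFrom (hW.add (contDiff_const.mul (hq.dx.contDiff_x t₀))) hb
  xPart x := by rw [xOp, dx_evolvedFrom_self, evolvedFrom_self, evolvedFrom_self, hab, sub_self]
  tPart_left := tOp_evolvedFrom
  tPart_right := tOp_evolvedFrom

theorem exists_forall_hasDerivAt_mul_self {g : ℝ → ℂ} (hg : ContDiff ℝ ∞ g) :
    ∃ φ : ℝ → ℂ, ContDiff ℝ ∞ φ ∧ (∀ x, HasDerivAt φ (g x * φ x) x) ∧ ∀ x, φ x ≠ 0 := by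
  have hG (x : ℝ) : HasDerivAt (fun x ↦ ∫ y in (0 : ℝ)..x, g y) (g x) x :=
    hg.continuous.integral_hasStrictDerivAt 0 x |>.hasDerivAt
  have hG_smooth : ContDiff ℝ ∞ fun x ↦ ∫ y in (0 : ℝ)..x, g y :=
    contDiff_infty_iff_deriv.2 ⟨fun x ↦ (hG x).differentiableAt, by
      rwa [funext fun x ↦ (hG x).deriv]⟩
  exact ⟨fun x ↦ exp (∫ y in (0 : ℝ)..x, g y), hG_smooth.cexp,
    fun x ↦ mul_comm (g x) _ ▸ (hG x).cexp, fun x ↦ exp_ne_zero _⟩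

theorem exists_satisfiesLaxPair_ne_zero (hq : Smooth q) (hW : ContDiff ℝ ∞ fun x ↦ W x t₀)
    (μ ν : ℂ) : ∃ φ χ, SatisfiesLaxPair q W μ ν φ χ t₀ ∧ ∀ x, φ x t₀ ≠ 0 := by
  obtain ⟨a, ha, ha', ha₀⟩ := exists_forall_hasDerivAt_mul_self (g := fun x ↦ -I * (q x t₀ + μ))
    (contDiff_const.mul ((hq.contDiff_x t₀).add contDiff_const))
  refine ⟨_, _, satisfiesLaxPair_evolvedFrom (b := 0) hq hW ha contDiff_const fun x ↦ ?_,
    fun x ↦ (evolvedFrom_self x).trans_ne (ha₀ x)⟩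
  rw [(ha' x).deriv, Pi.zero_apply]
  linear_combination -(q x t₀ + μ) * a x * I_sq

/-- For `ν ≠ 0` the `x`-part can be solved for `χ`, so that `φ = 1` is admissible. -/
theorem exists_xPeriodic_satisfiesLaxPair_ne_zero (hq : SmoothXPeriodic L q)
    (hW : SmoothPeriodic L fun x ↦ W x t₀) (μ : ℂ) (hν : ν ≠ 0) :
    ∃ φ χ, SatisfiesLaxPair q W μ ν φ χ t₀ ∧ XPeriodic L φ ∧ XPeriodic L χ ∧
      ∀ x, φ x t₀ ≠ 0 := by
  have hb : ContDiff ℝ ∞ fun x ↦ (-q x t₀ - μ) / ν :=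
    ((hq.smooth.contDiff_x t₀).neg.sub contDiff_const).div_const ν
  refine ⟨_, _, satisfiesLaxPair_evolvedFrom (a := 1) hq.smooth hW.contDiff contDiff_const hb
    fun x ↦ ?_, xPeriodic_evolvedFrom (fun x ↦ ?_) fun _ ↦ rfl,
    xPeriodic_evolvedFrom (fun x ↦ ?_) fun x ↦ ?_,
    fun x ↦ (evolvedFrom_self x).trans_ne one_ne_zero⟩
  · rw [Pi.one_def, deriv_const, mul_zero, zero_add, mul_one, mul_div_cancel₀ _ hν]
  · simp only [hW.periodic x, hq.dx.periodic x t₀]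
  · simp only [hW.periodic x, hq.dx.periodic x t₀]
  · simp only [hq.periodic x t₀]

end InitialData

section Compatibility

open Complex

variable {L δ : ℝ} {f g u v : ℝ → ℝ → ℂ} {μ ν₁ ν₂ A₀ σ : ℂ} {Ψ : ContourData} {t : ℝ}

/-- The part `T f_x + T̃ g_x + A₀` of the coefficient in the `t`-part that `ψ⁺` and `ψ⁻` share. -/
def nonlocalPotential (L δ : ℝ) (f g : ℝ → ℝ → ℂ) (A₀ : ℂ) (x t : ℝ) : ℂ :=
  opT L δ (fun y ↦ dx f y t) x + opTt L δ (fun y ↦ dx g y t) x + A₀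

theorem SmoothXPeriodic.smoothPeriodic_nonlocalPotential (hf : SmoothXPeriodic L f)
    (hg : SmoothXPeriodic L g) (hL : 0 < L) (hδ : 0 < δ) (A₀ : ℂ) (t : ℝ) :
    SmoothPeriodic L fun x ↦ nonlocalPotential L δ f g A₀ x t := by
  have hTf := (hf.dx.smoothPeriodic t).opT hL hδ
  have hTg := (hg.dx.smoothPeriodic t).opTt hL hδ
  exact ⟨(hTf.contDiff.add hTg.contDiff).add contDiff_const, fun x ↦ by
    simp only [nonlocalPotential, hTf.periodic x, hTg.periodic x]⟩

theorem SmoothXPeriodic.dx_nonlocalPotential (hf : SmoothXPeriodic L f)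
    (hg : SmoothXPeriodic L g) (hL : 0 < L) (hδ : 0 < δ) (A₀ : ℂ) (x t : ℝ) :
    NcILW.dx (nonlocalPotential L δ f g A₀) x t =
      opT L δ (fun y ↦ NcILW.dx (NcILW.dx f) y t) x +
        opTt L δ (fun y ↦ NcILW.dx (NcILW.dx g) y t) x :=
  ((((hf.dx.smoothPeriodic t).hasDerivAt_opT hL hδ x).add
    ((hg.dx.smoothPeriodic t).hasDerivAt_opTt hL hδ x)).add_const A₀).deriv

theorem isSolution_iff (hu : SmoothXPeriodic L u) (hv : SmoothXPeriodic L v) (hL : 0 < L)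
    (hδ : 0 < δ) (A₀ : ℂ) :
    IsSolution L δ u v ↔ ∀ x t, burgersDefect u (nonlocalPotential L δ u v A₀) x t = 0 ∧
      burgersDefect (-v) (nonlocalPotential L δ v u A₀) x t = 0 := by
  refine forall₂_congr fun x t ↦ ?_
  simp only [burgersDefect, dt_neg, dx_neg, Pi.neg_apply, hu.dx_nonlocalPotential hv hL hδ,
    hv.dx_nonlocalPotential hu hL hδ, ← add_assoc]
  refine and_congr_right' ?_
  rw [← neg_eq_zero]
  ring_nf

theorem tEquation_iff {φ : ℝ → ℝ → ℂ} {x : ℝ} :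
    TEquation L δ f g μ A₀ σ φ x t ↔
      tOp μ (fun x t ↦ nonlocalPotential L δ f g A₀ x t + σ * (I * dx f x t)) φ x t = 0 := by
  rw [TEquation, tOp, nonlocalPotential, add_right_comm _ A₀]

theorem tEquation_one_iff {φ : ℝ → ℝ → ℂ} {x : ℝ} :
    TEquation L δ f g μ A₀ 1 φ x t ↔
      tOp μ (fun x t ↦ nonlocalPotential L δ f g A₀ x t + I * dx f x t) φ x t = 0 := by
  simp only [tEquation_iff, one_mul]

theorem tEquation_neg_one_iff {φ : ℝ → ℝ → ℂ} {x : ℝ} :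
    TEquation L δ f g μ A₀ (-1) φ x t ↔
      tOp μ (fun x t ↦ nonlocalPotential L δ f g A₀ x t - I * dx f x t) φ x t = 0 := by
  simp only [tEquation_iff, neg_one_mul, ← sub_eq_add_neg]

theorem xDefect₀_eq : xDefect₀ u μ ν₁ Ψ = fun x t ↦ xOp u μ Ψ.neg₀ x t - ν₁ * Ψ.pos₀ x t := rfl

theorem xDefectδ_eq :
    xDefectδ v μ ν₂ Ψ = fun x t ↦ xOp (-v) μ Ψ.posδ x t - ν₂ * Ψ.negδ x t := by
  ext x t
  simp only [xDefectδ, xOp, Pi.neg_apply, neg_neg]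

theorem satisfiesLaxPair_iff :
    (Ψ.IsSmooth ∧ XPart u v μ ν₁ ν₂ Ψ t ∧ TPart L δ u v μ A₀ Ψ t) ↔
      SatisfiesLaxPair u (nonlocalPotential L δ u v A₀) μ ν₁ Ψ.neg₀ Ψ.pos₀ t ∧
        SatisfiesLaxPair (-v) (nonlocalPotential L δ v u A₀) μ ν₂ Ψ.posδ Ψ.negδ t := by
  simp only [ContourData.IsSmooth, XPart, TPart, tEquation_one_iff, tEquation_neg_one_iff,
    xDefect₀_eq, xDefectδ_eq, forall_and]
  constructor
  · rintro ⟨⟨hpos₀, hneg₀, hposδ, hnegδ⟩, ⟨hx₀, hxδ⟩, htpos₀, htneg₀, htposδ, htnegδ⟩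
    refine ⟨⟨hneg₀, hpos₀, hx₀, htneg₀, htpos₀⟩, ⟨hposδ, hnegδ, hxδ, ?_, ?_⟩⟩
    · simpa only [dx_neg, Pi.neg_apply, mul_neg, sub_neg_eq_add] using htposδ
    · simpa only [dx_neg, Pi.neg_apply, mul_neg, ← sub_eq_add_neg] using htnegδ
  · rintro ⟨⟨hneg₀, hpos₀, hx₀, htneg₀, htpos₀⟩, ⟨hposδ, hnegδ, hxδ, htposδ, htnegδ⟩⟩
    refine ⟨⟨hpos₀, hneg₀, hposδ, hnegδ⟩, ⟨hx₀, hxδ⟩, htpos₀, htneg₀, ?_, ?_⟩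
    · simpa only [dx_neg, Pi.neg_apply, mul_neg, sub_neg_eq_add] using htposδ
    · simpa only [dx_neg, Pi.neg_apply, mul_neg, ← sub_eq_add_neg] using htnegδ

theorem xPartDifferentiated_iff (hu : SmoothXPeriodic L u) (hv : SmoothXPeriodic L v)
    (hL : 0 < L) (hδ : 0 < δ) (hΨ : Ψ.IsSmooth) (hX : XPart u v μ ν₁ ν₂ Ψ t)
    (hT : TPart L δ u v μ A₀ Ψ t) :
    XPartDifferentiated u v μ ν₁ ν₂ Ψ t ↔
      ∀ x, burgersDefect u (nonlocalPotential L δ u v A₀) x t * Ψ.neg₀ x t = 0 ∧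
        burgersDefect (-v) (nonlocalPotential L δ v u A₀) x t * Ψ.posδ x t = 0 := by
  obtain ⟨h₀, hδ'⟩ := satisfiesLaxPair_iff.1 ⟨hΨ, hX, hT⟩
  have hWu := (hu.smoothPeriodic_nonlocalPotential hv hL hδ A₀ t).contDiff.differentiable (by simp)
  have hWv := (hv.smoothPeriodic_nonlocalPotential hu hL hδ A₀ t).contDiff.differentiable (by simp)
  refine forall_congr' fun x ↦ ?_
  rw [xDefect₀_eq, xDefectδ_eq, h₀.dt_xDefect hu.smooth (hWu x),
    hδ'.dt_xDefect hv.smooth.neg (hWv x), neg_eq_zero, neg_eq_zero]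

theorem compatible_of_isSolution (hu : SmoothXPeriodic L u) (hv : SmoothXPeriodic L v)
    (hL : 0 < L) (hδ : 0 < δ) (h : IsSolution L δ u v) : Compatible L δ u v μ ν₁ ν₂ A₀ := by
  intro Ψ t hΨ hX hT
  refine (xPartDifferentiated_iff hu hv hL hδ hΨ hX hT).2 fun x ↦ ?_
  have hx := (isSolution_iff hu hv hL hδ A₀).1 h x t
  exact ⟨mul_eq_zero_of_left hx.1 _, mul_eq_zero_of_left hx.2 _⟩

theorem SmoothXPeriodic.continuous_burgersDefect (hf : SmoothXPeriodic L f) {W : ℝ → ℝ → ℂ}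
    (hW : SmoothPeriodic L fun x ↦ W x t) : Continuous fun x ↦ burgersDefect f W x t := by
  have hWx : Continuous fun x ↦ NcILW.dx W x t := hW.deriv.contDiff.continuous
  have hf' := (hf.smooth.contDiff_x t).continuous
  have hfx := (hf.smooth.dx.contDiff_x t).continuous
  have hft := (hf.smooth.dt.contDiff_x t).continuous
  exact (hft.add ((continuous_const.mul hf').mul hfx)).add hWx

theorem isSolution_of_forall_dense (hu : SmoothXPeriodic L u) (hv : SmoothXPeriodic L v)
    (hL : 0 < L) (hδ : 0 < δ)
    (h : ∀ t, ∃ Ψ : ContourData, Ψ.IsSmooth ∧ XPart u v μ ν₁ ν₂ Ψ t ∧ TPart L δ u v μ A₀ Ψ t ∧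
      XPartDifferentiated u v μ ν₁ ν₂ Ψ t ∧
      Dense {x | Ψ.neg₀ x t ≠ 0} ∧ Dense {x | Ψ.posδ x t ≠ 0}) :
    IsSolution L δ u v := by
  refine (isSolution_iff hu hv hL hδ A₀).2 fun x t ↦ ?_
  obtain ⟨Ψ, hΨ, hX, hT, hXt, hneg₀, hposδ⟩ := h t
  have hzero := (xPartDifferentiated_iff hu hv hL hδ hΨ hX hT).1 hXt
  have hWu := hu.smoothPeriodic_nonlocalPotential hv hL hδ A₀ t
  have hWv := hv.smoothPeriodic_nonlocalPotential hu hL hδ A₀ t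
  exact ⟨congrFun ((hu.continuous_burgersDefect hWu).ext_on hneg₀ continuous_const
      fun x hx ↦ (mul_eq_zero.1 (hzero x).1).resolve_right hx) x,
    congrFun ((hv.neg.continuous_burgersDefect hWv).ext_on hposδ continuous_const
      fun x hx ↦ (mul_eq_zero.1 (hzero x).2).resolve_right hx) x⟩

theorem isSolution_of_compatible (hu : SmoothXPeriodic L u) (hv : SmoothXPeriodic L v)
    (hL : 0 < L) (hδ : 0 < δ) (h : Compatible L δ u v μ ν₁ ν₂ A₀) : IsSolution L δ u v := by
  refine isSolution_of_forall_dense (μ := μ) (ν₁ := ν₁) (ν₂ := ν₂) (A₀ := A₀) hu hv hL hδ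
    fun t ↦ ?_
  obtain ⟨neg₀, pos₀, h₀, hne₀⟩ := exists_satisfiesLaxPair_ne_zero hu.smooth
    (hu.smoothPeriodic_nonlocalPotential hv hL hδ A₀ t).contDiff μ ν₁
  obtain ⟨posδ, negδ, hδ', hneδ⟩ := exists_satisfiesLaxPair_ne_zero hv.smooth.neg
    (hv.smoothPeriodic_nonlocalPotential hu hL hδ A₀ t).contDiff μ ν₂
  obtain ⟨hΨ, hX, hT⟩ := satisfiesLaxPair_iff (Ψ := ⟨pos₀, neg₀, posδ, negδ⟩).2 ⟨h₀, hδ'⟩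
  exact ⟨_, hΨ, hX, hT, h _ t hΨ hX hT, by simp [hne₀], by simp [hneδ]⟩

theorem isSolution_of_compatiblePeriodic (hu : SmoothXPeriodic L u) (hv : SmoothXPeriodic L v)
    (hL : 0 < L) (hδ : 0 < δ) (hν₁ : ν₁ ≠ 0) (hν₂ : ν₂ ≠ 0)
    (h : CompatiblePeriodic L δ u v μ ν₁ ν₂ A₀) : IsSolution L δ u v := by
  refine isSolution_of_forall_dense (μ := μ) (ν₁ := ν₁) (ν₂ := ν₂) (A₀ := A₀) hu hv hL hδ
    fun t ↦ ?_
  obtain ⟨neg₀, pos₀, h₀, hper_neg₀, hper_pos₀, hne₀⟩ :=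
    exists_xPeriodic_satisfiesLaxPair_ne_zero hu
      (hu.smoothPeriodic_nonlocalPotential hv hL hδ A₀ t) μ hν₁
  obtain ⟨posδ, negδ, hδ', hper_posδ, hper_negδ, hneδ⟩ :=
    exists_xPeriodic_satisfiesLaxPair_ne_zero hv.neg
      (hv.smoothPeriodic_nonlocalPotential hu hL hδ A₀ t) μ hν₂
  obtain ⟨hΨ, hX, hT⟩ := satisfiesLaxPair_iff (Ψ := ⟨pos₀, neg₀, posδ, negδ⟩).2 ⟨h₀, hδ'⟩
  exact ⟨_, hΨ, hX, hT, h _ t hΨ ⟨hper_pos₀, hper_neg₀, hper_posδ, hper_negδ⟩ hX hT,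
    by simp [hne₀], by simp [hneδ]⟩

end Compatibility

section Eigenfunctions

open Complex Set

variable {L δ : ℝ} {u v : ℝ → ℝ → ℂ} {μ ν₁ ν₂ A₀ : ℂ} {ψ : ℂ → ℝ → ℂ} {Ψ : ContourData} {t : ℝ}

theorem strip_subset_offContour (hδ : 0 ≤ δ) (n : ℤ) :
    im ⁻¹' Ioo (n * δ) ((n + 1) * δ) ⊆ offContour δ := by
  rintro z ⟨hnz, hzn⟩ m hm
  rw [hm] at hnz hzn
  have hnm : n < m := by exact_mod_cast lt_of_mul_lt_mul_right hnz hδ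
  have hmn : m < n + 1 := by exact_mod_cast lt_of_mul_lt_mul_right hzn hδ
  lia

theorem lowerStrip_subset_offContour (hδ : 0 ≤ δ) : im ⁻¹' Ioo (-δ) 0 ⊆ offContour δ := by
  simpa using strip_subset_offContour hδ (-1)

theorem upperStrip_subset_offContour (hδ : 0 ≤ δ) : im ⁻¹' Ioo 0 δ ⊆ offContour δ := by
  simpa using strip_subset_offContour hδ 0

theorem exists_sub_mul_mem_strip (hδ : 0 < δ) {z : ℂ} (hz : z ∈ offContour δ) :
    ∃ n : ℤ, z - n * (2 * I * δ) ∈ im ⁻¹' Ioo (-δ) 0 ∨ z - n * (2 * I * δ) ∈ im ⁻¹' Ioo 0 δ := by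
  obtain ⟨n, ⟨hn, hn'⟩, -⟩ := existsUnique_sub_zsmul_mem_Ico (mul_pos two_pos hδ) z.im (-δ)
  rw [zsmul_eq_mul] at hn hn'
  have him : (z - n * (2 * I * δ)).im = z.im - n * (2 * δ) := by simp
  have off₀ : z.im - n * (2 * δ) ≠ 0 := fun h ↦ hz (2 * n) (by push_cast; linarith)
  have offδ : -δ ≠ z.im - n * (2 * δ) := fun h ↦ hz (2 * n - 1) (by push_cast; linarith)
  refine ⟨n, ?_⟩
  simp only [mem_preimage, him]
  exact off₀.lt_or_gt.imp (fun h ↦ ⟨hn.lt_of_ne offδ, h⟩) fun h ↦ ⟨h, by linarith⟩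

namespace IsEigenfunction

theorem sub_int_mul_eq (h : IsEigenfunction L δ u v μ ν₁ ν₂ A₀ ψ Ψ) (z : ℂ) (t : ℝ) (n : ℤ) :
    ψ (z - n * (2 * I * δ)) t = ψ z t :=
  Function.Periodic.sub_int_mul_eq (f := fun z ↦ ψ z t) (fun z ↦ h.periodic_imag z t) n

theorem tendsto_neg₀ (h : IsEigenfunction L δ u v μ ν₁ ν₂ A₀ ψ Ψ) (x t : ℝ) :
    Tendsto (ψ · t) (𝓝[im ⁻¹' Ioo (-δ) 0] (x + (0 : ℝ) * I)) (𝓝 (Ψ.neg₀ x t)) := by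
  rw [ofReal_zero, zero_mul, add_zero]
  exact (h.boundary_neg₀ x t).mono_left (nhdsWithin_mono _ fun _ hz ↦ hz.2)

theorem tendsto_pos₀ (h : IsEigenfunction L δ u v μ ν₁ ν₂ A₀ ψ Ψ) (x t : ℝ) :
    Tendsto (ψ · t) (𝓝[im ⁻¹' Ioo 0 δ] (x + (0 : ℝ) * I)) (𝓝 (Ψ.pos₀ x t)) := by
  rw [ofReal_zero, zero_mul, add_zero]
  exact (h.boundary_pos₀ x t).mono_left (nhdsWithin_mono _ fun _ hz ↦ hz.1)

theorem tendsto_negδ (h : IsEigenfunction L δ u v μ ν₁ ν₂ A₀ ψ Ψ) (x t : ℝ) :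
    Tendsto (ψ · t) (𝓝[im ⁻¹' Ioo 0 δ] (x + δ * I)) (𝓝 (Ψ.negδ x t)) := by
  rw [mul_comm]
  exact (h.boundary_negδ x t).mono_left (nhdsWithin_mono _ fun _ hz ↦ hz.2)

/-- On the torus the strip above `Π_δ` is the strip `-δ < Im z < 0` below `Π₀`. -/
theorem tendsto_posδ (h : IsEigenfunction L δ u v μ ν₁ ν₂ A₀ ψ Ψ) (x t : ℝ) :
    Tendsto (ψ · t) (𝓝[im ⁻¹' Ioo (-δ) 0] (x + (-δ : ℝ) * I)) (𝓝 (Ψ.posδ x t)) := by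
  have hshift : Tendsto (· + 2 * I * (δ : ℂ)) (𝓝[im ⁻¹' Ioo (-δ) 0] (x + (-δ : ℝ) * I))
      (𝓝[{z | δ < z.im}] (x + I * δ)) := by
    refine tendsto_nhdsWithin_iff.2 ⟨?_, eventually_mem_nhdsWithin.mono fun z hz ↦ ?_⟩
    · refine ((continuous_add_const _).tendsto' _ _ ?_).mono_left nhdsWithin_le_nhds
      push_cast
      ring
    · have hzδ : -δ < z.im := hz.1
      suffices δ < z.im + 2 * δ by simpa
      linarith
  simpa only [Function.comp_def, h.periodic_imag] using (h.boundary_posδ x t).comp hshift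

theorem eqOn_zero_of_eqOn_strips (hδ : 0 < δ) (h : IsEigenfunction L δ u v μ ν₁ ν₂ A₀ ψ Ψ)
    (hlower : EqOn (ψ · t) 0 (im ⁻¹' Ioo (-δ) 0)) (hupper : EqOn (ψ · t) 0 (im ⁻¹' Ioo 0 δ)) :
    EqOn (ψ · t) 0 (offContour δ) := by
  intro z hz
  obtain ⟨n, hn | hn⟩ := exists_sub_mul_mem_strip hδ hz
  · exact (h.sub_int_mul_eq z t n).symm.trans (hlower hn)
  · exact (h.sub_int_mul_eq z t n).symm.trans (hupper hn)

theorem eqOn_zero_upperStrip (hδ : 0 < δ) (h : IsEigenfunction L δ u v μ ν₁ ν₂ A₀ ψ Ψ)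
    (hν : ν₁ ≠ 0 ∨ ν₂ ≠ 0) (hlower : EqOn (ψ · t) 0 (im ⁻¹' Ioo (-δ) 0)) :
    EqOn (ψ · t) 0 (im ⁻¹' Ioo 0 δ) := by
  have neg₀_zero : ∀ x, Ψ.neg₀ x t = 0 := boundaryValue_eq_zero
    (by simp [closure_Ioo, hδ.le, hδ.ne']) (h.tendsto_neg₀ · t) hlower
  have posδ_zero : ∀ x, Ψ.posδ x t = 0 := boundaryValue_eq_zero
    (by simp [closure_Ioo, hδ.le, hδ.ne']) (h.tendsto_posδ · t) hlower
  have hdiff := (h.analytic t).mono (upperStrip_subset_offContour hδ.le)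
  by_contra hne
  simp only [EqOn, not_forall, exists_prop] at hne
  obtain hν₁ | hν₂ := hν
  · obtain ⟨x, hx⟩ := (dense_boundaryValues_ne_zero hδ (by simp [frontier_Ioo hδ]) hdiff
      (h.tendsto_pos₀ · t) hne).nonempty
    have hX := (h.xPart t x).1
    simp only [xDefect₀_eq, xOp_eq_zero neg₀_zero, zero_sub, neg_eq_zero] at hX
    exact mul_ne_zero hν₁ hx hX
  · obtain ⟨x, hx⟩ := (dense_boundaryValues_ne_zero hδ (by simp [frontier_Ioo hδ]) hdiff
      (h.tendsto_negδ · t) hne).nonempty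
    have hX := (h.xPart t x).2
    simp only [xDefectδ_eq, xOp_eq_zero posδ_zero, zero_sub, neg_eq_zero] at hX
    exact mul_ne_zero hν₂ hx hX

theorem exists_mem_lowerStrip_ne_zero (hδ : 0 < δ) (h : IsEigenfunction L δ u v μ ν₁ ν₂ A₀ ψ Ψ)
    (hne : ∃ z ∈ offContour δ, ψ z t ≠ 0 ∧ (ν₁ = 0 → ν₂ = 0 → -δ < z.im ∧ z.im < 0)) :
    ∃ z ∈ im ⁻¹' Ioo (-δ) 0, ψ z t ≠ 0 := by
  by_contra! hlower
  obtain ⟨z, hz, hψz, hν⟩ := hne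
  by_cases hν₀ : ν₁ = 0 ∧ ν₂ = 0
  · exact hψz (hlower z (hν hν₀.1 hν₀.2))
  · exact hψz (h.eqOn_zero_of_eqOn_strips hδ hlower
      (h.eqOn_zero_upperStrip hδ (not_and_or.1 hν₀) hlower) hz)

theorem xPartDifferentiated (h : IsEigenfunction L δ u v μ ν₁ ν₂ A₀ ψ Ψ) (t : ℝ) :
    XPartDifferentiated u v μ ν₁ ν₂ Ψ t := fun x ↦ by
  simp only [dt, (h.xPart _ x).1, (h.xPart _ x).2, deriv_const, and_self]

end IsEigenfunction

theorem isSolution_of_isEigenfunction (hu : SmoothXPeriodic L u) (hv : SmoothXPeriodic L v)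
    (hL : 0 < L) (hδ : 0 < δ) (h : IsEigenfunction L δ u v μ ν₁ ν₂ A₀ ψ Ψ)
    (hne : ∀ t, ∃ z ∈ offContour δ, ψ z t ≠ 0 ∧ (ν₁ = 0 → ν₂ = 0 → -δ < z.im ∧ z.im < 0)) :
    IsSolution L δ u v := by
  refine isSolution_of_forall_dense hu hv hL hδ fun t ↦
    ⟨Ψ, h.smooth, h.xPart t, h.tPart t, h.xPartDifferentiated t, ?_⟩
  have hdiff := (h.analytic t).mono (lowerStrip_subset_offContour hδ.le)
  have hstrip := h.exists_mem_lowerStrip_ne_zero hδ (hne t)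
  have hδ₀ : -δ < 0 := neg_lt_zero.2 hδ
  exact ⟨dense_boundaryValues_ne_zero hδ₀ (by simp [frontier_Ioo hδ₀]) hdiff
      (h.tendsto_neg₀ · t) hstrip,
    dense_boundaryValues_ne_zero hδ₀ (by simp [frontier_Ioo hδ₀]) hdiff
      (h.tendsto_posδ · t) hstrip⟩

end Eigenfunctions

end

end NcILW

theorem mainTheorem1 (L δ : ℝ) (hL : 0 < L) (hδ : 0 < δ) (u v : ℝ → ℝ → ℂ)
    (hu : NcILW.Smooth u) (hv : NcILW.Smooth v)
    (hup : NcILW.XPeriodic L u) (hvp : NcILW.XPeriodic L v)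
    (μ ν₁ ν₂ A₀ : ℂ → ℂ) (k : ℂ) :
    (NcILW.IsSolution L δ u v ↔ NcILW.Compatible L δ u v (μ k) (ν₁ k) (ν₂ k) (A₀ k)) ∧
    (ν₁ k ≠ 0 → ν₂ k ≠ 0 →
      (NcILW.IsSolution L δ u v ↔
        NcILW.CompatiblePeriodic L δ u v (μ k) (ν₁ k) (ν₂ k) (A₀ k))) ∧
    (∀ (ψ : ℂ → ℝ → ℂ) (Ψ : NcILW.ContourData),
      NcILW.IsEigenfunction L δ u v (μ k) (ν₁ k) (ν₂ k) (A₀ k) ψ Ψ →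
      (∀ t : ℝ, ∃ z ∈ NcILW.offContour δ, ψ z t ≠ 0 ∧
        (ν₁ k = 0 → ν₂ k = 0 → -δ < z.im ∧ z.im < 0)) →
      NcILW.IsSolution L δ u v) := by
  have hu' : NcILW.SmoothXPeriodic L u := ⟨hu, hup⟩
  have hv' : NcILW.SmoothXPeriodic L v := ⟨hv, hvp⟩
  have hcomp : NcILW.IsSolution L δ u v → NcILW.Compatible L δ u v (μ k) (ν₁ k) (ν₂ k) (A₀ k) :=
    NcILW.compatible_of_isSolution hu' hv' hL hδ
  exact ⟨⟨hcomp, NcILW.isSolution_of_compatible hu' hv' hL hδ⟩,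
    fun hν₁ hν₂ ↦ ⟨fun h Ψ t hΨ _ ↦ hcomp h Ψ t hΨ,
      NcILW.isSolution_of_compatiblePeriodic hu' hv' hL hδ hν₁ hν₂⟩,
    fun _ _ h hne ↦ NcILW.isSolution_of_isEigenfunction hu' hv' hL hδ h hne⟩
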